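/- Let $\boldsymbol\lambda=(\lambda_1\ge\dots\ge\lambda_n\ge 0)$ and $\boldsymbol\mu=(\mu_1\ge\dots\ge\mu_n\ge 0)$ be integer partitions (padded with zeros if necessary) with $\mu_i\le\lambda_i$ for all $i$, and let $N=\sum_i(\lambda_i-\mu_i)$ be the number of boxes of the skew Young diagram $\boldsymbol\lambda/\boldsymbol\mu=\{(i,j):\mu_i<j\le\lambda_i\}$, drawn in the English convention. Let $\mathcal P_{\boldsymbol\lambda/\boldsymbol\mu,\mathbf 1}\subset\mathbb R^{(N+1)n}$ be the Gelfand–Tsetlin polytope of weight $\mathbf 1=(1,\dots,1)$ ($N$ ones), i.e. the set of all arrays $(x^i_j)_{1\le i\le N+1,\,1\le j\le n}$ of non-negative real numbers such that $x^{i+1}_j\ge x^i_j$ and $x^i_j\ge x^{i+1}_{j+1}$ whenever both sides are defined, $\mathbf x^1=\boldsymbol\mu$, $\mathbf x^{N+1}=\boldsymbol\lambda$, and $\sum_j x^{i+1}_j-\sum_j x^i_j=1$ for $1\le i\le N$. A polytope is called integral if all its vertices are integer points. Then $\mathcal P_{\boldsymbol\lambda/\boldsymbol\mu,\mathbf 1}$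 is integral if and only if the diagram obtained from $\boldsymbol\lambda/\boldsymbol\mu$ by deleting all empty rows and columns is one of the following: 1. a disjoint union of finitely many (possibly zero) rows of boxes, i.e. rows placed one below the other, each lying entirely to the left of the rows above it, with no empty column in between; 2. a $2\times2$ box; 3. a hook, i.e. the union of the first row and the first column of an $l\times h$ rectangle of boxes ($l,h\ge1$), or such a hook with its corner box (the top left one) missing; or a reverse hook, i.e. the union of the last row and the last column of an $l\times h$ rectangle, or such a reverse hook with its corner box (the bottom right one) missing. -/

import Mathlib

/-! ### Gelfand--Tsetlin polytopes

Partitions are weakly decreasing vectors `Fin n → ℕ` (padding with zeros is allowed).  Rows, columns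
and pattern rows are numbered from `0`. -/

/-- A parallelogram array `x` of reals with `k + 1` rows of `n` entries is a Gelfand--Tsetlin
pattern: its entries are non-negative and adjacent rows interlace. Row `0` is the bottom row. -/
structure IsGTPattern {k n : ℕ} (x : Fin (k + 1) → Fin n → ℝ) : Prop where
  nonneg : ∀ i j, 0 ≤ x i j
  le_succ : ∀ (i : Fin k) (j : Fin n), x i.castSucc j ≤ x i.succ j
  succ_le : ∀ (i : Fin k) (j j' : Fin n), (j : ℕ) + 1 = j' → x i.succ j' ≤ x i.castSucc j

/-- The Gelfand--Tsetlin polytope with bottom row `mu`, top row `lam` and weight `w`. -/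
def gtPolytope {k n : ℕ} (lam mu : Fin n → ℕ) (w : Fin k → ℕ) :
    Set (Fin (k + 1) → Fin n → ℝ) :=
  {x | IsGTPattern x ∧ (∀ j, x 0 j = mu j) ∧ (∀ j, x (Fin.last k) j = lam j) ∧
    ∀ i : Fin k, ∑ j, x i.succ j - ∑ j, x i.castSucc j = w i}

/-- A polytope is integral if all its vertices (extreme points) are integer points. -/
def IsIntegralPolytope {k n : ℕ} (P : Set (Fin (k + 1) → Fin n → ℝ)) : Prop :=
  ∀ x ∈ P.extremePoints ℝ, ∀ i j, ∃ z : ℤ, x i j = z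

/-- The number of boxes of the skew shape `lam / mu` (for `mu ≤ lam`). -/
def skewSize {n : ℕ} (lam mu : Fin n → ℕ) : ℕ := ∑ i, (lam i - mu i)

/-- The weight `(1, …, 1)`, whose length is the number of boxes of `lam / mu`. -/
def onesWeight {n : ℕ} (lam mu : Fin n → ℕ) : Fin (skewSize lam mu) → ℕ := fun _ => 1

/-! ### Diagrams: finite sets of boxes `(row, column)`, in the English convention -/

/-- The skew Young diagram of shape `lam / mu`. -/
def skewDiagram {n : ℕ} (lam mu : Fin n → ℕ) : Finset (ℕ × ℕ) :=
  Finset.univ.biUnion fun i : Fin n => {(i : ℕ)} ×ˢ Finset.Ico (mu i) (lam i)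

/-- Delete all empty rows and columns: a box moves to the position given by the number of
non-empty rows above it and of non-empty columns to its left. -/
def deleteEmpty (D : Finset (ℕ × ℕ)) : Finset (ℕ × ℕ) :=
  D.image fun c => (((D.image Prod.fst).filter (· < c.1)).card,
    ((D.image Prod.snd).filter (· < c.2)).card)

/-- The number of rows of a diagram, i.e. one more than its last non-empty row. -/
def diagramHeight (D : Finset (ℕ × ℕ)) : ℕ := D.sup fun c => c.1 + 1

/-- The number of columns of a diagram, i.e. one more than its last non-empty column. -/
def diagramWidth (D : Finset (ℕ × ℕ)) : ℕ := D.sup fun c => c.2 + 1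

/-- The disjoint union of two diagrams: `A` is put to the right of and above `B`. -/
def disjointUnion (A B : Finset (ℕ × ℕ)) : Finset (ℕ × ℕ) :=
  (A.image fun c => (c.1, c.2 + diagramWidth B)) ∪ (B.image fun c => (c.1 + diagramHeight A, c.2))

/-- A single row of `a` boxes. -/
def rowDiagram (a : ℕ) : Finset (ℕ × ℕ) := {0} ×ˢ Finset.range a

/-- The disjoint union of rows whose lengths, from top to bottom, are the entries of the list. -/
def rowsDiagram : List ℕ → Finset (ℕ × ℕ)
  | [] => ∅
  | a :: l => disjointUnion (rowDiagram a) (rowsDiagram l)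

/-- The `2 × 2` box. -/
def boxDiagram : Finset (ℕ × ℕ) := Finset.range 2 ×ˢ Finset.range 2

/-- The hook with first row of `a + 1` boxes and first column of `b + 1` boxes;
its corner is `(0, 0)`. -/
def hookDiagram (a b : ℕ) : Finset (ℕ × ℕ) :=
  {0} ×ˢ Finset.range (a + 1) ∪ Finset.range (b + 1) ×ˢ {0}

/-- The reverse hook with last row of `a + 1` boxes and last column of `b + 1` boxes;
its corner is `(b, a)`. -/
def reverseHookDiagram (a b : ℕ) : Finset (ℕ × ℕ) :=
  {b} ×ˢ Finset.range (a + 1) ∪ Finset.range (b + 1) ×ˢ {a}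

def IsDisjointUnionOfRows (D : Finset (ℕ × ℕ)) : Prop := ∃ l : List ℕ, D = rowsDiagram l

/-- A hook, possibly with the corner box missing. -/
def IsHook (D : Finset (ℕ × ℕ)) : Prop :=
  ∃ a b : ℕ, D = hookDiagram a b ∨ D = (hookDiagram a b).erase (0, 0)

/-- A reverse hook, possibly with the corner box missing. -/
def IsReverseHook (D : Finset (ℕ × ℕ)) : Prop :=
  ∃ a b : ℕ, D = reverseHookDiagram a b ∨ D = (reverseHookDiagram a b).erase (b, a)

/-! Necessity. A point determined by its tight inequalities is a vertex
(`mem_extremePoints_of_rigid`), and it stays determined when an integral row differing by one box is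
put before or after the pattern. So it suffices to find partitions `mu ≤ rho ≤ nu ≤ lam` with `nu /
rho` of four boxes and a rigid half-integral pattern from `rho` to `nu`. Let a vertical domino lie
in rows `u` and `v = u + 1`, with extra boxes in rows `p` and `q`; fill half boxes in pairs `(u,
p)`, `(p, v)`, `(u, q)`, `(v, q)`. Ties make the deviations of the two domino boxes equal, while a
level sum makes them opposite, so the pattern is rigid (`hasRigidNonintegralPoint_of_domino`). Thus
in an integral shape a domino tolerates at most one extra box of a suitable kind
(`HasSmallDominoes`), and looking at a single domino leaves only the listed shapes
(`HasSmallDominoes.classification`).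

Sufficiency. For disjoint rows interlacing is automatic, and the polytope is a transportation
polytope, governed by Birkhoff's theorem on doubly stochastic matrices. In the other cases fix one
row `j₀`. For a monotone `φ` fixing the integers, apply `φ` to all entries outside `j₀` and correct
the entry at `j₀` to keep the level sums. The maps `squeeze` and `2 * t - squeeze t` average to the
identity; if both images lie in the polytope, an extreme point is fixed by `squeeze`, hence
integral. Only inequalities involving `j₀` need work. For hooks `j₀` is the horizontal arm: the
other rows form one column, so in a single step they sweep out disjoint intervals of total length at
most 1, and the entry at `j₀` cannot decrease. For the square the inequalities leave only one free
entry.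

Finally, deleting empty rows and columns replaces coordinates by ranks, and the hook conditions
mention only the order of coordinates. -/

/-! ### Vertices certified by tight inequalities. -/

/-- Every defining inequality which is tight at `x` is tight at `y`. -/
structure PreservesTies {k n : ℕ} (x y : Fin (k + 1) → Fin n → ℝ) : Prop where
  castSucc_eq : ∀ (i : Fin k) (j : Fin n), x i.castSucc j = x i.succ j → y i.castSucc j = y i.succ j
  succ_eq : ∀ (i : Fin k) (j j' : Fin n), (j : ℕ) + 1 = j' → x i.succ j' = x i.castSucc j →
    y i.succ j' = y i.castSucc j

/-- The polytope of weight `(1, …, 1)` has a non-integral point which is determined by its tight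
inequalities. -/
def HasRigidNonintegralPoint {n : ℕ} (k : ℕ) (lam mu : Fin n → ℕ) : Prop :=
  ∃ x ∈ gtPolytope lam mu (fun _ : Fin k => 1),
    (∀ y ∈ gtPolytope lam mu (fun _ : Fin k => 1), PreservesTies x y → y = x) ∧
      ∃ i j, ∀ z : ℤ, x i j ≠ z

theorem sum_level_of_mem_gtPolytope {k n : ℕ} {lam mu : Fin n → ℕ} {x : Fin (k + 1) → Fin n → ℝ}
    (hx : x ∈ gtPolytope lam mu (fun _ : Fin k => 1)) (i : Fin (k + 1)) :
    ∑ j, x i j = ∑ j, (mu j : ℝ) + (i : ℕ) := by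
  induction i using Fin.induction with
  | zero => simp [hx.2.1]
  | succ i ih =>
    have := hx.2.2.2 i
    simp only [Fin.val_castSucc] at ih
    push_cast [Fin.val_succ] at this ⊢
    linarith

theorem sum_eq_of_mem_gtPolytope {k n : ℕ} {lam mu : Fin n → ℕ} {x : Fin (k + 1) → Fin n → ℝ}
    (hx : x ∈ gtPolytope lam mu (fun _ : Fin k => 1)) : ∑ j, lam j = ∑ j, mu j + k := by
  have := sum_level_of_mem_gtPolytope hx (Fin.last k)
  simp only [hx.2.2.1, Fin.val_last] at this
  exact_mod_cast this

/-- An inequality that is tight at an interior point of a segment in the polytope is tight at its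
ends, so rigidity identifies an end with `x`. -/
theorem mem_extremePoints_of_rigid {k n : ℕ} {lam mu : Fin n → ℕ} {w : Fin k → ℕ}
    {x : Fin (k + 1) → Fin n → ℝ} (hx : x ∈ gtPolytope lam mu w)
    (h : ∀ y ∈ gtPolytope lam mu w, PreservesTies x y → y = x) :
    x ∈ (gtPolytope lam mu w).extremePoints ℝ := by
  refine ⟨hx, fun y hy z hz hxyz => h y hy ?_⟩
  obtain ⟨a, b, ha, hb, hab, rfl⟩ := hxyz
  constructor
  · intro i j hij
    have h1 := hy.1.le_succ i j
    have h2 := hz.1.le_succ i j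
    simp only [Pi.add_apply, Pi.smul_apply, smul_eq_mul] at hij
    nlinarith
  · intro i j j' hj hij
    have h1 := hy.1.succ_le i j j' hj
    have h2 := hz.1.succ_le i j j' hj
    simp only [Pi.add_apply, Pi.smul_apply, smul_eq_mul] at hij
    nlinarith

theorem HasRigidNonintegralPoint.not_isIntegralPolytope {n : ℕ} {k : ℕ} {lam mu : Fin n → ℕ}
    (hle : mu ≤ lam) (h : HasRigidNonintegralPoint k lam mu) :
    ¬ IsIntegralPolytope (gtPolytope lam mu (onesWeight lam mu)) := by
  obtain ⟨x, hx, hr, i, j, hij⟩ := h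
  -- The number of steps is forced by the sums of the end rows, which is why `k` may be left free in
  -- `HasRigidNonintegralPoint`.
  have hk : k = skewSize lam mu := by
    have h1 := sum_eq_of_mem_gtPolytope hx
    have h2 : ∑ j, (lam j - mu j) + ∑ j, mu j = ∑ j, lam j := by
      rw [← Finset.sum_add_distrib]
      exact Finset.sum_congr rfl fun j _ => Nat.sub_add_cancel (hle j)
    unfold skewSize
    omega
  subst hk
  intro hint
  obtain ⟨z, hz⟩ := hint x (mem_extremePoints_of_rigid hx hr) i j
  exact hij z hz

/-! ### Extending a rigid point by integral rows. -/

/-- A new bottom row which differs from the old one by one box. -/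
theorem HasRigidNonintegralPoint.cons {n k : ℕ} {lam mu mu' : Fin n → ℕ} (hmu : Antitone mu)
    (hmu' : Antitone mu') (r : Fin n) (hr : mu' r = mu r + 1) (hne : ∀ j ≠ r, mu' j = mu j)
    (h : HasRigidNonintegralPoint k lam mu') : HasRigidNonintegralPoint (k + 1) lam mu := by
  obtain ⟨x, ⟨hx, hx0, hx1, hxs⟩, hrig, i₀, j₀, hij⟩ := h
  have hsum : ∑ j, (mu' j : ℝ) = ∑ j, (mu j : ℝ) + 1 := by
    rw [← Finset.add_sum_erase _ _ (Finset.mem_univ r),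
      ← Finset.add_sum_erase _ (fun j => (mu j : ℝ)) (Finset.mem_univ r), hr,
      Finset.sum_congr rfl fun j hj => by rw [hne j (Finset.ne_of_mem_erase hj)]]
    push_cast
    ring
  have hle : ∀ j, mu j ≤ mu' j := fun j => by
    by_cases hj : j = r
    · subst hj; omega
    · exact (hne j hj).ge
  have hint : ∀ j j' : Fin n, (j : ℕ) + 1 = j' → mu' j' ≤ mu j := fun j j' hj => by
    have hjj : j ≤ j' := by rw [Fin.le_def]; omega
    by_cases h' : j' = r
    · have : j ≠ r := by rintro rfl; simp [h'] at hj
      rw [← hne j this]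
      exact hmu' hjj
    · rw [hne j' h']
      exact hmu hjj
  refine ⟨Fin.cons (fun j => (mu j : ℝ)) x, ⟨⟨?_, ?_, ?_⟩, ?_, ?_, ?_⟩, ?_, i₀.succ, j₀, ?_⟩
  · intro i j
    cases i using Fin.cases with
    | zero => simp
    | succ i => simpa using hx.nonneg i j
  · intro i j
    cases i using Fin.cases with
    | zero => simpa [hx0] using hle j
    | succ i => simpa [← Fin.succ_castSucc] using hx.le_succ i j
  · intro i j j' hj
    cases i using Fin.cases with
    | zero => simpa [hx0] using hint j j' hj
    | succ i => simpa [← Fin.succ_castSucc] using hx.succ_le i j j' hj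
  · simp
  · intro j
    rw [← Fin.succ_last]
    simpa using hx1 j
  · intro i
    cases i using Fin.cases with
    | zero => simp [hx0, hsum]
    | succ i => simpa [← Fin.succ_castSucc] using hxs i
  · rintro y ⟨hy, hy0, hy1, hys⟩ ht
    -- Outside row `r` the entries are tied to the bottom row, and the weight condition then fixes
    -- the entry in row `r`. So the rest of `y` starts at `mu'` and the rigidity of `x` applies to
    -- it.
    have hy1' : ∀ j, y (Fin.succ 0) j = mu' j := by
      have hj : ∀ j ≠ r, y (Fin.succ 0) j = mu' j := fun j hj => by
        rw [← ht.castSucc_eq 0 j (by simp [hx0, hne j hj]), hne j hj]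
        exact hy0 j
      intro j
      by_cases hjr : j = r
      · subst hjr
        have h1 := hys 0
        rw [Fin.castSucc_zero, Finset.sum_congr rfl fun j _ => hy0 j] at h1
        have h2 : ∑ j, y (Fin.succ 0) j = ∑ j, (mu' j : ℝ) := by
          push_cast at h1
          linarith
        rw [← Finset.add_sum_erase _ _ (Finset.mem_univ j),
          ← Finset.add_sum_erase _ (fun j => (mu' j : ℝ)) (Finset.mem_univ j),
          Finset.sum_congr rfl fun j hj' => by rw [hj j (Finset.ne_of_mem_erase hj')]] at h2
        linarith
      · exact hj j hjr
    have : (fun i => y i.succ) = x := by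
      refine hrig _ ⟨⟨fun i j => hy.nonneg _ _, fun i j => ?_, fun i j j' hj => ?_⟩, hy1', ?_, ?_⟩ ⟨?_, ?_⟩
      · simpa using hy.le_succ i.succ j
      · simpa using hy.succ_le i.succ j j' hj
      · simpa [Fin.succ_last] using hy1
      · intro i
        simpa using hys i.succ
      · intro i j h'
        have := ht.castSucc_eq i.succ j
        simp only [← Fin.succ_castSucc, Fin.cons_succ] at this
        exact this h'
      · intro i j j' hj h'
        have := ht.succ_eq i.succ j j' hj
        simp only [← Fin.succ_castSucc, Fin.cons_succ] at this
        exact this h'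
    funext i j
    cases i using Fin.cases with
    | zero => simp [hy0]
    | succ i => simp [← this]
  · simpa using hij

/-- A new top row which differs from the old one by one box. -/
theorem HasRigidNonintegralPoint.snoc {n k : ℕ} {lam lam' mu : Fin n → ℕ} (hlam : Antitone lam)
    (hlam' : Antitone lam') (r : Fin n) (hr : lam' r = lam r + 1) (hne : ∀ j ≠ r, lam' j = lam j)
    (h : HasRigidNonintegralPoint k lam mu) : HasRigidNonintegralPoint (k + 1) lam' mu := by
  obtain ⟨x, ⟨hx, hx0, hx1, hxs⟩, hrig, i₀, j₀, hij⟩ := h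
  have hsum : ∑ j, (lam' j : ℝ) = ∑ j, (lam j : ℝ) + 1 := by
    rw [← Finset.add_sum_erase _ _ (Finset.mem_univ r),
      ← Finset.add_sum_erase _ (fun j => (lam j : ℝ)) (Finset.mem_univ r), hr,
      Finset.sum_congr rfl fun j hj => by rw [hne j (Finset.ne_of_mem_erase hj)]]
    push_cast
    ring
  have hle : ∀ j, lam j ≤ lam' j := fun j => by
    by_cases hj : j = r
    · subst hj; omega
    · exact (hne j hj).ge
  have hint : ∀ j j' : Fin n, (j : ℕ) + 1 = j' → lam' j' ≤ lam j := fun j j' hj => by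
    have hjj : j ≤ j' := by rw [Fin.le_def]; omega
    by_cases h' : j' = r
    · have : j ≠ r := by rintro rfl; simp [h'] at hj
      rw [← hne j this]
      exact hlam' hjj
    · rw [hne j' h']
      exact hlam hjj
  refine ⟨Fin.snoc (α := fun _ => Fin n → ℝ) x (fun j => (lam' j : ℝ)),
    ⟨⟨?_, ?_, ?_⟩, ?_, ?_, ?_⟩, ?_, i₀.castSucc, j₀, ?_⟩
  · intro i j
    cases i using Fin.lastCases with
    | last => simp
    | cast i => simpa using hx.nonneg i j
  · intro i j
    cases i using Fin.lastCases with
    | last => simpa [hx1] using hle j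
    | cast i => simpa [-Fin.castSucc_succ, Fin.succ_castSucc] using hx.le_succ i j
  · intro i j j' hj
    cases i using Fin.lastCases with
    | last => simpa [hx1] using hint j j' hj
    | cast i => simpa [-Fin.castSucc_succ, Fin.succ_castSucc] using hx.succ_le i j j' hj
  · intro j
    rw [← Fin.castSucc_zero]
    simpa using hx0 j
  · simp
  · intro i
    cases i using Fin.lastCases with
    | last => simp [hx1, hsum]
    | cast i => simpa [-Fin.castSucc_succ, Fin.succ_castSucc] using hxs i
  · rintro y ⟨hy, hy0, hy1, hys⟩ ht
    have hy1' : ∀ j, y (Fin.last k).castSucc j = lam j := by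
      have hj : ∀ j ≠ r, y (Fin.last k).castSucc j = lam j := fun j hj => by
        rw [ht.castSucc_eq (Fin.last k) j (by simp [hx1, hne j hj]), ← hne j hj]
        exact hy1 j
      intro j
      by_cases hjr : j = r
      · subst hjr
        have h1 := hys (Fin.last k)
        rw [Fin.succ_last, Finset.sum_congr rfl fun j _ => hy1 j] at h1
        have h2 : ∑ j, y (Fin.last k).castSucc j = ∑ j, (lam j : ℝ) := by
          push_cast at h1
          linarith
        rw [← Finset.add_sum_erase _ _ (Finset.mem_univ j),
          ← Finset.add_sum_erase _ (fun j => (lam j : ℝ)) (Finset.mem_univ j),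
          Finset.sum_congr rfl fun j hj' => by rw [hj j (Finset.ne_of_mem_erase hj')]] at h2
        linarith
      · exact hj j hjr
    have : (fun i => y i.castSucc) = x := by
      refine hrig _ ⟨⟨fun i j => hy.nonneg _ _, fun i j => ?_, fun i j j' hj => ?_⟩, ?_, hy1', ?_⟩ ⟨?_, ?_⟩
      · simpa [-Fin.castSucc_succ, Fin.succ_castSucc] using hy.le_succ i.castSucc j
      · simpa [-Fin.castSucc_succ, Fin.succ_castSucc] using hy.succ_le i.castSucc j j' hj
      · simpa using hy0
      · intro i
        simpa [-Fin.castSucc_succ, Fin.succ_castSucc] using hys i.castSucc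
      · intro i j h'
        have := ht.castSucc_eq i.castSucc j
        simp only [Fin.succ_castSucc, Fin.snoc_castSucc] at this
        exact this h'
      · intro i j j' hj h'
        have := ht.succ_eq i.castSucc j j' hj
        simp only [Fin.succ_castSucc, Fin.snoc_castSucc] at this
        exact this h'
    funext i j
    cases i using Fin.lastCases with
    | last => simp [hy1]
    | cast i => simp [← this]
  · simpa using hij

/-- The topmost row in which `mu` falls short of `rho` can be lengthened, because the rows above it
already agree with the decreasing sequence `rho`. -/
theorem exists_add_box {n : ℕ} {mu rho : Fin n → ℕ} (hmu : Antitone mu) (hrho : Antitone rho)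
    (hle : mu ≤ rho) (hne : mu ≠ rho) :
    ∃ (r : Fin n) (mu' : Fin n → ℕ), Antitone mu' ∧ mu' ≤ rho ∧ mu' r = mu r + 1 ∧
      ∀ j ≠ r, mu' j = mu j := by
  have hex : (Finset.univ.filter fun j => mu j < rho j).Nonempty := by
    obtain ⟨j, hj⟩ := Function.ne_iff.1 hne
    exact ⟨j, by simpa using lt_of_le_of_ne (hle j) hj⟩
  obtain ⟨r, hr, hmin⟩ := Finset.exists_min_image _ id hex
  simp only [Finset.mem_filter, Finset.mem_univ, true_and, id] at hr hmin
  refine ⟨r, Function.update mu r (mu r + 1), ?_, ?_, by simp, fun j hj => by simp [hj]⟩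
  · intro a b hab
    by_cases hb : b = r
    · subst hb
      by_cases ha : a = b
      · simp [ha]
      · have h1 : ¬ mu a < rho a := fun h => ha (le_antisymm hab (hmin a h))
        have h2 := hrho hab
        simp only [Function.update_self, Function.update_of_ne ha]
        omega
    · have h1 := hmu hab
      by_cases ha : a = r
      · subst ha
        simp only [Function.update_self, Function.update_of_ne hb]
        omega
      · simpa [ha, hb] using h1
  · intro j
    by_cases hj : j = r
    · subst hj
      simpa using hr
    · simpa [hj] using hle j

theorem sum_sub_lt_of_add_box {n : ℕ} {mu mu' rho : Fin n → ℕ} (hle : mu' ≤ rho) (r : Fin n)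
    (hr : mu' r = mu r + 1) (hne : ∀ j ≠ r, mu' j = mu j) :
    ∑ j, (rho j - mu' j) < ∑ j, (rho j - mu j) := by
  refine Finset.sum_lt_sum (fun j _ => ?_) ⟨r, Finset.mem_univ r, ?_⟩
  · by_cases hj : j = r
    · subst hj; omega
    · rw [hne j hj]
  · have : mu' r ≤ rho r := hle r
    change rho r - mu' r < rho r - mu r
    omega

theorem HasRigidNonintegralPoint.extend_bottom {n k : ℕ} {lam mu rho : Fin n → ℕ}
    (hmu : Antitone mu) (hrho : Antitone rho) (hle : mu ≤ rho)
    (h : HasRigidNonintegralPoint k lam rho) : ∃ k', HasRigidNonintegralPoint k' lam mu := by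
  induction hm : ∑ j, (rho j - mu j) using Nat.strong_induction_on generalizing mu with
  | _ m ih =>
    by_cases hne : mu = rho
    · exact ⟨k, hne ▸ h⟩
    · obtain ⟨r, mu', h1, h2, h3, h4⟩ := exists_add_box hmu hrho hle hne
      obtain ⟨k', hk'⟩ := ih _ (hm ▸ sum_sub_lt_of_add_box h2 r h3 h4) h1 h2 rfl
      exact ⟨k' + 1, hk'.cons hmu h1 r h3 h4⟩

theorem HasRigidNonintegralPoint.extend_top {n k : ℕ} {lam mu nu : Fin n → ℕ}
    (hnu : Antitone nu) (hlam : Antitone lam) (hle : nu ≤ lam)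
    (h : HasRigidNonintegralPoint k nu mu) : ∃ k', HasRigidNonintegralPoint k' lam mu := by
  induction hm : ∑ j, (lam j - nu j) using Nat.strong_induction_on generalizing nu k with
  | _ m ih =>
    by_cases hne : nu = lam
    · exact ⟨k, hne ▸ h⟩
    · obtain ⟨r, nu', h1, h2, h3, h4⟩ := exists_add_box hnu hlam hle hne
      exact ih _ (hm ▸ sum_sub_lt_of_add_box h2 r h3 h4) h1 h2 (h.snoc hnu h1 r h3 h4) rfl

/-! ### The half-integral pattern of a domino with two extra boxes. -/

/-- Four boxes, in rows `u`, `v = u + 1`, `p`, `q`, where the boxes in rows `u` and `v` form a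
vertical domino, give rise to a half-integral point. -/
theorem hasRigidNonintegralPoint_of_domino {n : ℕ} {rho nu : Fin n → ℕ} (hrho : Antitone rho)
    (hnu : Antitone nu) (u v p q : Fin n) (huv : (u : ℕ) + 1 = v) (hpu : p ≠ u) (hqv : q ≠ v)
    (hpq : p ≠ q)
    (hnu_eq : ∀ j, nu j = rho j + (if j = u then 1 else 0) + (if j = v then 1 else 0) +
      (if j = p then 1 else 0) + (if j = q then 1 else 0))
    (hrho_eq : rho u = rho v + if v = p then 1 else 0)
    (habove : ∀ j : Fin n, (j : ℕ) + 1 = u → rho u + 1 ≤ rho j)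
    (hbelow : ∀ j : Fin n, (v : ℕ) + 1 = j → nu j ≤ rho u)
    (hqp : (q : ℕ) + 1 = p → q = u) : HasRigidNonintegralPoint 4 nu rho := by
  have huv' : u ≠ v := by rintro rfl; omega
  obtain ⟨δ, hδ⟩ : ∃ δ : Fin n → Fin n → ℕ, ∀ a j, δ a j = if j = a then 1 else 0 := ⟨_, fun _ _ => rfl⟩
  have hδs : ∀ a, ∑ j, δ a j = 1 := fun a => by simp [hδ]
  have hδ0 : ∀ {a j}, j ≠ a → δ a j = 0 := fun h => by simp [hδ, h]
  have hδ1 : ∀ a, δ a a = 1 := fun a => by simp [hδ]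
  simp only [← hδ] at hnu_eq hrho_eq
  -- The doubled pattern, so that interlacing is checked in `ℕ`. The upper domino box is half filled
  -- at levels 1 and 2, the lower one at levels 2 and 3. The cases `p = v` and `q = u` are included.
  obtain ⟨A, hA⟩ : ∃ A : Fin 5 → Fin n → ℕ, A = ![fun j => 2 * rho j,
    fun j => 2 * rho j + δ u j + δ p j, fun j => 2 * rho j + 2 * δ p j + δ u j + δ v j,
    fun j => 2 * rho j + 2 * δ u j + 2 * δ p j + δ v j + δ q j, fun j => 2 * nu j] := ⟨_, rfl⟩
  have hA0 : ∀ j, A 0 j = 2 * rho j := fun j => by simp [hA]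
  have hA1 : ∀ j, A 1 j = 2 * rho j + δ u j + δ p j := fun j => by simp [hA]
  have hA2 : ∀ j, A 2 j = 2 * rho j + 2 * δ p j + δ u j + δ v j := fun j => by simp [hA]
  have hA3 : ∀ j, A 3 j = 2 * rho j + 2 * δ u j + 2 * δ p j + δ v j + δ q j :=
    fun j => by simp [hA]
  have hA4 : ∀ j, A 4 j = 2 * nu j := fun j => by simp [hA]
  clear hA
  have hsum : ∀ i : Fin 4, ∑ j, A i.succ j = ∑ j, A i.castSucc j + 2 := by
    intro i
    fin_cases i <;> simp [hA0, hA1, hA2, hA3, hA4, hnu_eq, Finset.sum_add_distrib,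
      ← Finset.mul_sum, hδs] <;> ring
  have hle : ∀ (i : Fin 4) (j : Fin n), A i.castSucc j ≤ A i.succ j := by
    intro i j
    have := hnu_eq j
    fin_cases i <;> simp [hA0, hA1, hA2, hA3, hA4] <;> omega
  have hint : ∀ (i : Fin 4) (j j' : Fin n), (j : ℕ) + 1 = j' → A i.succ j' ≤ A i.castSucc j := by
    intro i j j' hj
    have e1 := hnu_eq j
    have e2 := hnu_eq j'
    have hjj : j ≤ j' := by rw [Fin.le_def]; omega
    have e3 := hrho hjj
    have e4 := hnu hjj
    have e5 : δ v j' = δ u j := by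
      simp only [hδ, Fin.ext_iff]
      split_ifs <;> omega
    have hdisj : ∀ {a b : Fin n}, a ≠ b → ∀ j, δ a j + δ b j ≤ 1 := fun {a b} hab j => by
      by_cases h : j = a
      · rw [h, hδ1, hδ0 hab]
      · rw [hδ0 h, hδ]
        split_ifs <;> omega
    have e6 := hdisj hpu j
    have e7 := hdisj hqv j
    have e8 := hdisj hpq j
    have e9 := hdisj huv' j
    have f6 := hdisj hpu j'
    have f7 := hdisj hqv j'
    have f8 := hdisj hpq j'
    have f9 := hdisj huv' j'
    have hne : ∀ a, δ a j + δ a j' ≤ 1 := fun a => by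
      by_cases h : j = a
      · have h' : j' ≠ a := by rintro rfl; simp [h] at hj
        rw [h, hδ1, hδ0 h']
      · rw [hδ0 h, hδ]
        split_ifs <;> omega
    have k1 := hne u
    have k2 := hne v
    have k3 := hne p
    have k4 := hne q
    -- If row `p` came right after row `q`, its box could lie under that of `q` although it is
    -- filled earlier. This is permitted only for `q = u`, where `p = v` and `hrho_eq` leaves room.
    have g1 : δ q j + δ p j' ≤ 1 + δ u j := by
      simp only [hδ]
      split_ifs <;> omega
    have g2 : δ u j' = 1 → rho j' + 1 ≤ rho j := fun h => by
      have : j' = u := by by_contra h'; simp [hδ0 h'] at h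
      subst this
      exact habove j hj
    have g3 : δ v j = 1 → nu j' ≤ rho j + δ p j := fun h => by
      have : j = v := by by_contra h'; simp [hδ0 h'] at h
      subst this
      exact hrho_eq ▸ hbelow j' hj
    have g4 : δ v j' = 1 → rho j = rho j' + δ p j' := fun h => by
      have h1 : j' = v := by by_contra h'; simp [hδ0 h'] at h
      have h2 : j = u := by rw [Fin.ext_iff]; rw [Fin.ext_iff] at h1; omega
      subst h1 h2
      exact hrho_eq
    fin_cases i <;> simp [hA0, hA1, hA2, hA3, hA4] <;> omega
  obtain ⟨x, hx⟩ : ∃ x : Fin 5 → Fin n → ℝ, ∀ i j, x i j = (A i j : ℝ) / 2 := ⟨_, fun _ _ => rfl⟩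
  have hxA : ∀ {i i' j j'}, A i j = A i' j' → x i j = x i' j' := fun h => by rw [hx, hx, h]
  have hxP : x ∈ gtPolytope nu rho (fun _ : Fin 4 => 1) := by
    refine ⟨⟨fun i j => ?_, fun i j => ?_, fun i j j' hj => ?_⟩, fun j => ?_, fun j => ?_, fun i => ?_⟩
    · rw [hx]; positivity
    · rw [hx, hx]
      have : (A i.castSucc j : ℝ) ≤ A i.succ j := by exact_mod_cast hle i j
      linarith
    · rw [hx, hx]
      have : (A i.succ j' : ℝ) ≤ A i.castSucc j := by exact_mod_cast hint i j j' hj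
      linarith
    · rw [hx, hA0]; push_cast; ring
    · rw [hx, show Fin.last 4 = 4 from rfl, hA4]; push_cast; ring
    · simp only [hx, ← Finset.sum_div]
      have : (∑ j, (A i.succ j : ℝ)) = ∑ j, (A i.castSucc j : ℝ) + 2 := by exact_mod_cast hsum i
      rw [this]; push_cast; ring
  refine ⟨x, hxP, fun y hy ht => ?_, 1, u, fun z hz => ?_⟩
  -- The deviation `e` is constant along ties, sums to zero on each level and vanishes on the end
  -- rows.
  · obtain ⟨e, he⟩ : ∃ e : Fin 5 → Fin n → ℝ, ∀ i j, e i j = y i j - x i j := ⟨_, fun _ _ => rfl⟩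
    have hes : ∀ i, ∑ j, e i j = 0 := fun i => by
      simp only [he, Finset.sum_sub_distrib]
      rw [sum_level_of_mem_gtPolytope hy i, sum_level_of_mem_gtPolytope hxP i, sub_self]
    have he0 : ∀ j, e 0 j = 0 := fun j => by rw [he, hy.2.1, hxP.2.1, sub_self]
    have he4 : ∀ j, e 4 j = 0 := fun j => by
      rw [he, show (4 : Fin 5) = Fin.last 4 from rfl, hy.2.2.1, hxP.2.2.1, sub_self]
    have hv : ∀ (i : Fin 4) (j : Fin n), A i.castSucc j = A i.succ j →
        e i.castSucc j = e i.succ j := fun i j h => by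
      rw [he, he, hxA h, ht.castSucc_eq i j (hxA h)]
    have hd : ∀ (i : Fin 4), A i.succ v = A i.castSucc u → e i.succ v = e i.castSucc u :=
      fun i h => by rw [he, he, hxA h, ht.succ_eq i u v huv (hxA h)]
    have hpair : ∀ (i : Fin 5) {a b : Fin n}, a ≠ b → (∀ j, j ≠ a → j ≠ b → e i j = 0) →
        e i a + e i b = 0 := fun i a b hab h => by
      rw [← hes i, Fintype.sum_eq_add a b hab fun j hj => h j hj.1 hj.2]
    have z1 : ∀ j, j ≠ u → j ≠ p → e 1 j = 0 := fun j hju hjp => by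
      by_cases hjv : j = v
      · subst hjv
        have := hd 0
        simp only [Fin.castSucc_zero, Fin.succ_zero_eq_one, hA0, hA1, he0] at this
        rw [hδ0 hjp] at hrho_eq
        exact this (by rw [hδ0 hju, hδ0 hjp, hrho_eq]; omega)
      · have := hv 0 j
        simp only [Fin.castSucc_zero, Fin.succ_zero_eq_one, hA0, hA1, he0] at this
        exact (this (by rw [hδ0 hju, hδ0 hjp]; omega)).symm
    -- The chain `e 1 u = e 2 u = e 2 v = e 3 v`. On level 2 all other deviations vanish, so `e 2 u
    -- + e 2 v = 0` annihilates the whole chain.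
    have h12u : e 1 u = e 2 u := hv 1 u (by
      change A 1 u = A 2 u
      rw [hA1, hA2, hδ0 (Ne.symm hpu), hδ0 huv']; omega)
    have h12v : e 2 v = e 1 u := hd 1 (by
      change A 2 v = A 1 u
      rw [hA1, hA2, hδ0 (Ne.symm hpu), hδ0 huv'.symm, hδ1, hδ1]; omega)
    have h23v : e 2 v = e 3 v := hv 2 v (by
      change A 2 v = A 3 v
      rw [hA2, hA3, hδ0 huv'.symm, hδ0 (Ne.symm hqv)]; omega)
    have z2 : ∀ j, j ≠ u → j ≠ v → e 2 j = 0 := fun j hju hjv => by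
      by_cases hjp : j = p
      · have h1 : e 2 j = e 3 j := hv 2 j (by
          change A 2 j = A 3 j
          subst hjp
          rw [hA2, hA3, hδ0 hju, hδ0 hjv, hδ0 hpq]; omega)
        have h2 : e 3 j = e 4 j := hv 3 j (by
          change A 3 j = A 4 j
          subst hjp
          rw [hA3, hA4, hnu_eq, hδ0 hju, hδ0 hjv, hδ0 hpq]; omega)
        rw [h1, h2, he4]
      · have h1 : e 1 j = e 2 j := hv 1 j (by
          change A 1 j = A 2 j
          rw [hA1, hA2, hδ0 hju, hδ0 hjv, hδ0 hjp])
        rw [← h1, z1 j hju hjp]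
    have z3 : ∀ j, j ≠ v → j ≠ q → e 3 j = 0 := fun j hjv hjq => by
      by_cases hju : j = u
      · subst hju
        have h1 : e 4 v = e 3 j := hd 3 (by
          change A 4 v = A 3 j
          rw [hA3, hA4, hnu_eq, hδ0 hjv, hδ0 hjv.symm, hδ0 hpu.symm, hδ0 hjq, hδ0 hqv.symm, hδ1,
            hδ1]
          omega)
        rw [← h1, he4]
      · have h1 : e 3 j = e 4 j := hv 3 j (by
          change A 3 j = A 4 j
          rw [hA3, hA4, hnu_eq, hδ0 hju, hδ0 hjv, hδ0 hjq]; omega)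
        rw [h1, he4]
    have s1 := hpair 1 hpu.symm z1
    have s2 := hpair 2 huv' z2
    have s3 := hpair 3 hqv.symm z3
    have hall : ∀ i j, e i j = 0 := by
      intro i j
      fin_cases i
      · exact he0 j
      · by_cases h1 : j = u
        · subst h1; change e 1 j = 0; linarith
        · by_cases h2 : j = p
          · subst h2; change e 1 j = 0; linarith
          · exact z1 j h1 h2
      · by_cases h1 : j = u
        · subst h1; change e 2 j = 0; linarith
        · by_cases h2 : j = v
          · subst h2; change e 2 j = 0; linarith
          · exact z2 j h1 h2
      · by_cases h1 : j = v
        · subst h1; change e 3 j = 0; linarith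
        · by_cases h2 : j = q
          · subst h2; change e 3 j = 0; linarith
          · exact z3 j h1 h2
      · exact he4 j
    funext i j
    have := hall i j
    rw [he] at this
    linarith
  · rw [hx, hA1, hδ1, hδ0 hpu.symm] at hz
    have : (2 * rho u + 1 : ℤ) = 2 * z := by
      have h2 : (2 * rho u + 1 : ℝ) = 2 * z := by push_cast at hz; linarith
      exact_mod_cast h2
    omega

/-! ### Placing the four boxes inside the given shape. -/

/-- Extension of a finite sequence by zeros. -/
def extendZero {n : ℕ} (f : Fin n → ℕ) (r : ℕ) : ℕ := if h : r < n then f ⟨r, h⟩ else 0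

theorem extendZero_coe {n : ℕ} (f : Fin n → ℕ) (j : Fin n) : extendZero f j = f j := by
  simp [extendZero]

theorem extendZero_of_le {n : ℕ} (f : Fin n → ℕ) {r : ℕ} (h : n ≤ r) : extendZero f r = 0 := by
  simp [extendZero, h]

theorem lt_of_extendZero_pos {n : ℕ} {f : Fin n → ℕ} {r : ℕ} (h : 0 < extendZero f r) : r < n := by
  by_contra h'
  rw [extendZero_of_le f (not_lt.1 h')] at h
  exact h.false

theorem antitone_extendZero {n : ℕ} {f : Fin n → ℕ} (hf : Antitone f) : Antitone (extendZero f) := by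
  intro a b hab
  unfold extendZero
  split_ifs with h1 h2
  · exact hf hab
  · omega
  · exact Nat.zero_le _
  · exact le_rfl

theorem extendZero_le {n : ℕ} {f g : Fin n → ℕ} (h : f ≤ g) (r : ℕ) :
    extendZero f r ≤ extendZero g r := by
  unfold extendZero
  split_ifs
  · exact h _
  · exact le_rfl

/-- The domino is in column `c`. An extra box is the left neighbour of the lower domino box (`p = u
+ 1`), the right neighbour of the upper one (`q = u`), the first box of a lower row starting left of
`c`, or the last box of a higher row reaching beyond `c`. The conditions on adjacent rows make `rho`
and `nu` partitions. -/
theorem not_isIntegralPolytope_of_domino {n : ℕ} {lam mu : Fin n → ℕ} (hlam : Antitone lam)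
    (hmu : Antitone mu) (hle : mu ≤ lam) {L M : ℕ → ℕ} (hL : L = extendZero lam)
    (hM : M = extendZero mu) {u c p q : ℕ} (hu : M u ≤ c) (hv : c < L (u + 1))
    (hp : (p = u + 1 ∧ M p < c) ∨ (u + 1 < p ∧ M p < c ∧ M p < L p) ∨
      (p < u ∧ c + 1 < L p ∧ M p < L p))
    (hp_below : ∀ j, j + 1 = p → u + 1 < j → M p < M j)
    (hp_above : ∀ j, j = p + 1 → j < u → L j < L p ∨ j = q)
    (hq : (q = u ∧ c + 1 < L q) ∨ (u + 1 < q ∧ M q < c ∧ M q < L q) ∨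
      (q < u ∧ c + 1 < L q ∧ M q < L q))
    (hq_below : ∀ j, j + 1 = q → u + 1 < j → M q < M j ∨ j = p)
    (hq_above : ∀ j, j = q + 1 → j < u → L j < L q)
    (hpq : p ≠ q) (hqp : q + 1 = p → q = u) :
    ¬ IsIntegralPolytope (gtPolytope lam mu (onesWeight lam mu)) := by
  have hLa : ∀ j, L (j + 1) ≤ L j := fun j => hL ▸ antitone_extendZero hlam (Nat.le_succ j)
  have hMa : ∀ j, M (j + 1) ≤ M j := fun j => hM ▸ antitone_extendZero hmu (Nat.le_succ j)
  have hML : ∀ j, M j ≤ L j := fun j => hL ▸ hM ▸ extendZero_le hle j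
  have hLn : ∀ j, 0 < L j → j < n := fun j h => lt_of_extendZero_pos (hL ▸ h)
  obtain ⟨δ, hδ⟩ : ∃ δ : ℕ → ℕ → ℕ, ∀ a j, δ a j = if j = a then 1 else 0 := ⟨_, fun _ _ => rfl⟩
  have hδ1 : ∀ a, δ a a = 1 := fun a => by simp [hδ]
  have hδ0 : ∀ {a j}, j ≠ a → δ a j = 0 := fun h => by simp [hδ, h]
  have hδp : ∀ j, j = p → δ p j = 1 ∧ δ q j = 0 := by rintro j rfl; exact ⟨hδ1 j, hδ0 hpq⟩
  have hδq : ∀ j, j = q → δ p j = 0 ∧ δ q j = 1 := by rintro j rfl; exact ⟨hδ0 hpq.symm, hδ1 j⟩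
  have hδn : ∀ j, j ≠ p → j ≠ q → δ p j = 0 ∧ δ q j = 0 := fun j h1 h2 => ⟨hδ0 h1, hδ0 h2⟩
  -- Higher rows are filled as in `L` except for their extra boxes, lower rows are left as in `M`,
  -- and the two middle rows stop just before the domino or its left neighbour.
  obtain ⟨rho, hrho⟩ : ∃ rho : ℕ → ℕ, ∀ j, rho j = if j < u then L j - δ p j - δ q j else
      if j = u then c else if j = u + 1 then c - δ p j else M j := ⟨_, fun _ => rfl⟩
  obtain ⟨nu, hnu⟩ : ∃ nu : ℕ → ℕ, ∀ j, nu j = rho j + δ u j + δ (u + 1) j + δ p j + δ q j :=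
    ⟨_, fun _ => rfl⟩
  have hLu := hLa u
  have hMu := hMa u
  have hb : ∀ j, j < u ∨ u + 1 < j → M j + δ p j + δ q j ≤ L j := fun j hj => by
    have h0 := hML j
    have h1 := hδp j
    have h2 := hδq j
    have h3 := hδn j
    by_cases hjp : j = p
    · subst hjp; omega
    · by_cases hjq : j = q
      · subst hjq; omega
      · omega
  have hv' : M (u + 1) + δ p (u + 1) ≤ c := by
    by_cases h : u + 1 = p
    · subst h
      rw [hδ1]
      omega
    · rw [hδ0 h]
      omega
  have hu' : c + 1 + δ q u ≤ L u := by
    by_cases h : u = q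
    · subst h
      rw [hδ1]
      omega
    · rw [hδ0 h]
      omega
  have habove : ∀ j, j < u → c + 1 + δ p j + δ q j ≤ L j := fun j hj => by
    have h0 : L u ≤ L j := hL ▸ antitone_extendZero hlam hj.le
    have h1 := hδp j
    have h2 := hδq j
    have h3 := hδn j
    by_cases hjp : j = p
    · subst hjp; omega
    · by_cases hjq : j = q
      · subst hjq; omega
      · omega
  have hbelow : ∀ j, u + 1 < j → M j + δ p j + δ q j ≤ c := fun j hj => by
    have h0 : M j ≤ M (u + 1) := hM ▸ antitone_extendZero hmu hj.le
    have h1 := hδp j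
    have h2 := hδq j
    have h3 := hδn j
    by_cases hjp : j = p
    · subst hjp; omega
    · by_cases hjq : j = q
      · subst hjq; omega
      · omega
  have hL' : ∀ j, j + 1 < u → L (j + 1) + δ p j + δ q j ≤ L j + δ p (j + 1) + δ q (j + 1) :=
      fun j hj => by
    have h0 := hLa j
    have h1 := hδp j
    have h2 := hδq j
    have h3 := hδn j
    by_cases hjp : j = p
    · subst hjp
      rcases hp_above _ rfl hj with h | h
      · omega
      · have := hδq _ h
        omega
    · by_cases hjq : j = q
      · subst hjq
        have := hq_above _ rfl hj
        omega
      · omega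
  have hM' : ∀ j, u + 1 < j → M (j + 1) + δ p (j + 1) + δ q (j + 1) ≤ M j + δ p j + δ q j :=
      fun j hj => by
    have h0 := hMa j
    have h1 := hδp (j + 1)
    have h2 := hδq (j + 1)
    have h3 := hδn (j + 1)
    by_cases hjp : j + 1 = p
    · subst hjp
      have := hp_below _ rfl hj
      omega
    · by_cases hjq : j + 1 = q
      · subst hjq
        rcases hq_below _ rfl hj with h | h
        · omega
        · have := hδp _ h
          omega
      · omega
  have hr : ∀ j, (j < u ∧ rho j + δ p j + δ q j = L j ∧ nu j = L j) ∨
      (j = u ∧ rho j = c ∧ nu j = c + 1 + δ q j) ∨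
      (j = u + 1 ∧ rho j + δ p j = c ∧ nu j = c + 1) ∨
      (u + 1 < j ∧ rho j = M j ∧ nu j = M j + δ p j + δ q j) := fun j => by
    have h2 := hrho j
    have h3 := hnu j
    rcases lt_trichotomy j u with h | h | h
    · have h1 := hb j (Or.inl h)
      rw [hδ u, hδ (u + 1), if_neg (by omega), if_neg (by omega)] at h3
      rw [if_pos h] at h2
      omega
    · subst h
      rw [hδ1, hδ0 (by omega : j ≠ j + 1), hδ0 (by omega : j ≠ p)] at h3
      rw [if_neg (by omega), if_pos rfl] at h2
      omega
    · by_cases h' : j = u + 1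
      · subst h'
        rw [hδ1, hδ0 (by omega : u + 1 ≠ u), hδ0 (by omega : u + 1 ≠ q)] at h3
        rw [if_neg (by omega), if_neg (by omega), if_pos rfl] at h2
        omega
      · rw [hδ u, hδ (u + 1), if_neg (by omega), if_neg (by omega)] at h3
        rw [if_neg (by omega), if_neg (by omega), if_neg h'] at h2
        omega
  have hra : Antitone rho := antitone_nat_of_succ_le fun j => by
    have h1 := hL' j
    have h2 := habove j
    have h3 := hMa j
    have h' := hr (j + 1)
    rcases hr j with h | h | ⟨rfl, h⟩ | h
    · omega
    · omega
    · omega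
    · omega
  have hna : Antitone nu := antitone_nat_of_succ_le fun j => by
    have h1 := hLa j
    have h2 := hbelow (j + 1)
    have h3 := hM' j
    rcases hr (j + 1) with h | ⟨h0, h⟩ | h | h
    · have := hr j
      omega
    · have := hr j
      rw [h0] at h1 h ⊢
      omega
    · have := hr j
      omega
    · have := hr j
      omega
  have hMr : ∀ j, M j ≤ rho j := fun j => by
    have := hb j
    rcases hr j with h | ⟨rfl, h⟩ | ⟨rfl, h⟩ | h <;> omega
  have hnL : ∀ j, nu j ≤ L j := fun j => by
    have := hb j
    rcases hr j with h | ⟨rfl, h⟩ | ⟨rfl, h⟩ | h <;> omega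
  have hvn : u + 1 < n := hLn _ (by omega)
  have hpn : p < n := by
    rcases hp with h | h | h
    · omega
    · exact hLn _ (by omega)
    · omega
  have hqn : q < n := by
    rcases hq with h | h | h
    · omega
    · exact hLn _ (by omega)
    · omega
  have base : HasRigidNonintegralPoint 4 (fun j : Fin n => nu j) (fun j : Fin n => rho j) := by
    refine hasRigidNonintegralPoint_of_domino (fun a b h => hra h) (fun a b h => hna h)
      ⟨u, by omega⟩ ⟨u + 1, hvn⟩ ⟨p, hpn⟩ ⟨q, hqn⟩ rfl ?_ ?_ ?_ (fun j => ?_) ?_ (fun j hj => ?_)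
      (fun j hj => ?_) ?_
    · simp only [ne_eq, Fin.mk.injEq]; omega
    · simp only [ne_eq, Fin.mk.injEq]; omega
    · simpa using hpq
    · simp only [hnu, hδ, Fin.ext_iff]
    · simp only [Fin.mk.injEq, ← hδ]
      have h1 := hr u
      have h2 := hr (u + 1)
      omega
    · have h1 := hr u
      have h2 := hr j
      have h3 := habove j
      simp only at hj ⊢
      omega
    · have h1 := hr u
      have h2 := hr j
      have h3 := hbelow j
      simp only at hj ⊢
      omega
    · simpa using hqp
  obtain ⟨k, hk⟩ := base.extend_bottom (mu := mu) hmu (fun a b h => hra h) fun j => by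
    have := hMr j
    rwa [hM, extendZero_coe] at this
  obtain ⟨k, hk⟩ := hk.extend_top (lam := lam) (fun a b h => hna h) hlam fun j => by
    have := hnL j
    rwa [hL, extendZero_coe] at this
  exact hk.not_isIntegralPolytope hle

/-! ### Forbidden configurations around a domino. -/

theorem exists_first_nonempty_row {L M : ℕ → ℕ} (hL : Antitone L) {s r : ℕ} (hsr : s < r)
    (hr : M r < L r) :
    ∃ p, s < p ∧ p ≤ r ∧ M p < L p ∧ ∀ j, j + 1 = p → s < j → M p < M j := by
  classical
  have hex : ∃ p, s < p ∧ M p < L p := ⟨r, hsr, hr⟩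
  obtain ⟨h1, h2⟩ := Nat.find_spec hex
  refine ⟨Nat.find hex, h1, Nat.find_min' hex ⟨hsr, hr⟩, h2, fun j hj hsj => ?_⟩
  have h3 := Nat.find_min hex (m := j) (by omega)
  have h4 := hL (show j ≤ Nat.find hex by omega)
  simp only [not_and, not_lt] at h3
  have := h3 hsj
  omega

/-- Take the nearest such row: a row strictly between `s` and `p` is empty or starts at column `c`
or later, and in both cases starts strictly to the right of row `p`. -/
theorem exists_first_row_below {L M : ℕ → ℕ} (hL : Antitone L) {s r c : ℕ} (hsr : s < r)
    (hr : M r < L r) (hc : M r < c) :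
    ∃ p, s < p ∧ p ≤ r ∧ M p < c ∧ M p < L p ∧ ∀ j, j + 1 = p → s < j → M p < M j := by
  classical
  have hex : ∃ p, s < p ∧ M p < c ∧ M p < L p := ⟨r, hsr, hc, hr⟩
  obtain ⟨h1, h2, h3⟩ := Nat.find_spec hex
  refine ⟨Nat.find hex, h1, Nat.find_min' hex ⟨hsr, hc, hr⟩, h2, h3, fun j hj hsj => ?_⟩
  have h4 := Nat.find_min hex (m := j) (by omega)
  have h5 := hL (show j ≤ Nat.find hex by omega)
  simp only [not_and, not_lt] at h4
  have := h4 hsj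
  omega

theorem exists_last_row_above {L M : ℕ → ℕ} (hM : Antitone M) {s r c : ℕ} (hsr : r < s)
    (hr : M r < L r) (hc : c < L r) :
    ∃ p, r ≤ p ∧ p < s ∧ c < L p ∧ M p < L p ∧ ∀ j, j = p + 1 → j < s → L j < L p := by
  classical
  obtain ⟨P, hP⟩ : ∃ P : ℕ → Prop, ∀ p, P p ↔ p < s ∧ c < L p ∧ M p < L p := ⟨_, fun _ => Iff.rfl⟩
  have hPr : P r := (hP r).2 ⟨hsr, hc, hr⟩
  obtain ⟨h1, h2, h3⟩ := (hP _).1 (Nat.findGreatest_spec hsr.le hPr)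
  refine ⟨Nat.findGreatest P s, Nat.le_findGreatest hsr.le hPr, h1, h2, h3, fun j hj hjs => ?_⟩
  have h4 := Nat.findGreatest_is_greatest (P := P) (n := s) (k := j) (by omega) hjs.le
  have h5 := hM (show Nat.findGreatest P s ≤ j by omega)
  rw [hP] at h4
  omega

/-- Row `r` contains a box which is to the left of and below, or to the right of and above, both
boxes in column `c` and rows `u`, `u + 1`. -/
def IsOuterRow (L M : ℕ → ℕ) (u c r : ℕ) : Prop :=
  M r < L r ∧ ((u + 1 < r ∧ M r < c) ∨ (r < u ∧ c + 1 < L r))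

/-- Every vertical domino of the shape `L / M` has at most one neighbour. -/
structure HasSmallDominoes (L M : ℕ → ℕ) : Prop where
  not_left_right : ∀ {u c}, M u ≤ c → c < L (u + 1) → ¬ (M (u + 1) < c ∧ c + 1 < L u)
  not_outer : ∀ {u c r}, M u ≤ c → c < L (u + 1) → M (u + 1) < c ∨ c + 1 < L u →
    ¬ IsOuterRow L M u c r
  outer_unique : ∀ {u c r r'}, M u ≤ c → c < L (u + 1) → IsOuterRow L M u c r →
    IsOuterRow L M u c r' → r = r'

theorem hasSmallDominoes_of_isIntegralPolytope {n : ℕ} {lam mu : Fin n → ℕ} (hlam : Antitone lam)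
    (hmu : Antitone mu) (hle : mu ≤ lam)
    (h : IsIntegralPolytope (gtPolytope lam mu (onesWeight lam mu))) :
    HasSmallDominoes (extendZero lam) (extendZero mu) := by
  have hLa := antitone_extendZero hlam
  have hMa := antitone_extendZero hmu
  obtain ⟨L, hL⟩ : ∃ L, L = extendZero lam := ⟨_, rfl⟩
  obtain ⟨M, hM⟩ : ∃ M, M = extendZero mu := ⟨_, rfl⟩
  rw [← hL] at hLa ⊢
  rw [← hM] at hMa ⊢
  have key := fun {u c p q : ℕ} (hu : M u ≤ c) (hv : c < L (u + 1)) hp h1 h2 hq h3 h4 h5 h6 =>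
    not_isIntegralPolytope_of_domino hlam hmu hle hL hM (u := u) (c := c) (p := p) (q := q) hu hv hp
      h1 h2 hq h3 h4 h5 h6 h
  have hlt : ∀ {u c r r'}, M u ≤ c → c < L (u + 1) → IsOuterRow L M u c r →
      IsOuterRow L M u c r' → ¬ r < r' := by
    rintro u c r r' hu hv ⟨h1, h2⟩ ⟨h1', h2'⟩ hrr
    rcases h2 with ⟨h2, h3⟩ | ⟨h2, h3⟩
    · obtain ⟨p, p1, p2, p3, p4, p5⟩ := exists_first_row_below hLa h2 h1 h3
      -- The second row need only be nonempty: lying below `p`, it automatically starts left of `c`.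
      obtain ⟨q, q1, q2, q3, q4⟩ := exists_first_nonempty_row hLa (show p < r' by omega) h1'
      have := hMa q1.le
      refine key hu hv (p := p) (q := q) (by omega) p5 (by omega) (by omega) (fun j hj hj' => ?_)
        (by omega) (by omega) (by omega)
      rcases lt_trichotomy p j with h | h | h
      · exact Or.inl (q4 j hj h)
      · exact Or.inr h.symm
      · omega
    · rcases h2' with ⟨h2', h3'⟩ | ⟨h2', h3'⟩
      · obtain ⟨p, p1, p2, p3, p4, p5⟩ := exists_first_row_below hLa h2' h1' h3'
        obtain ⟨q, q1, q2, q3, q4, q5⟩ := exists_last_row_above hMa h2 h1 h3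
        exact key hu hv (p := p) (q := q) (by omega) p5 (by omega) (by omega) (by omega) q5
          (by omega) (by omega)
      · obtain ⟨q, q1, q2, q3, q4, q5⟩ := exists_last_row_above hMa h2' h1' h3'
        obtain ⟨p, p1, p2, p3, p4, p5⟩ := exists_last_row_above hMa (show r < q by omega) h1 h3
        refine key hu hv (p := p) (q := q) (by omega) (by omega) (fun j hj hj' => ?_) (by omega)
          (by omega) q5 (by omega) (by omega)
        rcases lt_trichotomy j q with h | h | h
        · exact Or.inl (p5 j hj h)
        · exact Or.inr h
        · omega
  constructor
  · rintro u c hu hv ⟨h1, h2⟩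
    exact key hu hv (p := u + 1) (q := u) (by omega) (by omega) (by omega) (by omega) (by omega)
      (by omega) (by omega) (by omega)
  · rintro u c r hu hv hwe ⟨h1, ⟨h2, h3⟩ | ⟨h2, h3⟩⟩
    · obtain ⟨p, p1, p2, p3, p4, p5⟩ := exists_first_row_below hLa h2 h1 h3
      rcases hwe with h | h
      · exact key hu hv (p := u + 1) (q := p) (by omega) (by omega) (by omega) (by omega)
          (fun j hj hj' => Or.inl (p5 j hj hj')) (by omega) (by omega) (by omega)
      · exact key hu hv (p := p) (q := u) (by omega) p5 (by omega) (by omega) (by omega)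
          (by omega) (by omega) (by omega)
    · obtain ⟨p, p1, p2, p3, p4, p5⟩ := exists_last_row_above hMa h2 h1 h3
      rcases hwe with h | h
      · exact key hu hv (p := u + 1) (q := p) (by omega) (by omega) (by omega) (by omega)
          (by omega) p5 (by omega) (by omega)
      · exact key hu hv (p := p) (q := u) (by omega) (by omega)
          (fun j hj hj' => Or.inl (p5 j hj hj')) (by omega) (by omega)
          (by omega) (by omega) (by omega)
  · intro u c r r' hu hv h1 h2
    have := hlt hu hv h1 h2
    have := hlt hu hv h2 h1
    omega

/-! ### Classification of shapes with small dominoes. -/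

/-- Every box is in the first row or in the first column. -/
def IsHookShape (D : Finset (ℕ × ℕ)) : Prop :=
  ∀ b ∈ D, (∀ b' ∈ D, b.1 ≤ b'.1) ∨ (∀ b' ∈ D, b.2 ≤ b'.2)

/-- Every box is in the last row or in the last column. -/
def IsReverseHookShape (D : Finset (ℕ × ℕ)) : Prop :=
  ∀ b ∈ D, (∀ b' ∈ D, b'.1 ≤ b.1) ∨ (∀ b' ∈ D, b'.2 ≤ b.2)

/-- Inspect one domino, in column `c` of rows `u` and `u + 1`. If its upper box has a right
neighbour, no row is outer and `u` is the first row; the shape is a hook unless `(u + 1, c + 1)` is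
a box, when the domino in column `c + 1` forces a square. A left neighbour of the lower box is the
mirror case. With neither, all boxes outside at most one outer row are in column `c`: an outer row
above gives a hook, one below a reverse hook. -/
theorem HasSmallDominoes.classification {L M : ℕ → ℕ} (h : HasSmallDominoes L M)
    (hL : Antitone L) (hM : Antitone M) {D : Finset (ℕ × ℕ)}
    (hD : ∀ b, b ∈ D ↔ M b.1 ≤ b.2 ∧ b.2 < L b.1) :
    (∀ r, L (r + 1) ≤ M r) ∨ (∃ u c, D = ({u, u + 1} : Finset ℕ) ×ˢ ({c, c + 1} : Finset ℕ)) ∨ IsHookShape D ∨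
      IsReverseHookShape D := by
  by_cases hrow : ∀ r, L (r + 1) ≤ M r
  · exact Or.inl hrow
  refine Or.inr ?_
  push Not at hrow
  obtain ⟨u, hv⟩ := hrow
  obtain ⟨c, hu, hv⟩ : ∃ c, M u ≤ c ∧ c < L (u + 1) := ⟨M u, le_rfl, hv⟩
  have hLu := hL (Nat.le_succ u)
  have hMu := hM (Nat.le_succ u)
  simp only [Nat.succ_eq_add_one] at hLu hMu
  have hbox : ∀ c, (∀ r, M r < L r → r = u ∨ r = u + 1) → M u = c → M (u + 1) = c →
      L u = c + 2 → L (u + 1) = c + 2 → D = ({u, u + 1} : Finset ℕ) ×ˢ ({c, c + 1} : Finset ℕ) := fun c h1 h2 h3 h4 h5 => by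
    ext ⟨r, d⟩
    simp only [hD, Finset.mem_product, Finset.mem_insert, Finset.mem_singleton]
    constructor
    · rintro ⟨h6, h7⟩
      rcases h1 r (by omega) with rfl | rfl <;> omega
    · rintro ⟨rfl | rfl, h⟩ <;> omega
  by_cases hE : c + 1 < L u
  · have hW : ¬ M (u + 1) < c := fun hW => h.not_left_right hu hv ⟨hW, hE⟩
    have hout := fun r => h.not_outer (r := r) hu hv (Or.inr hE)
    have hup : ∀ r, M r < L r → u ≤ r := fun r hr => by
      by_contra hlt
      have := hL (show r ≤ u by omega)
      exact hout r ⟨hr, by omega⟩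
    by_cases hc : c + 1 < L (u + 1)
    · refine Or.inl ⟨u, c, hbox c (fun r hr => ?_) ?_ ?_ ?_ ?_⟩
      · by_contra hne
        have h1 := hup r hr
        have h2 := hM (show u + 1 ≤ r by omega)
        exact h.not_outer (c := c + 1) (r := r) (by omega) hc (by omega) ⟨hr, by omega⟩
      · omega
      · omega
      all_goals
        have := h.not_left_right (u := u) (c := c + 1) (by omega) hc
        omega
    · refine Or.inr (Or.inl fun b hb => ?_)
      rw [hD] at hb
      rcases (hup b.1 (by omega)).eq_or_lt with h1 | h1
      · refine Or.inl fun b' hb' => ?_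
        rw [hD] at hb'
        have := hup b'.1 (by omega)
        omega
      · refine Or.inr fun b' hb' => ?_
        rw [hD] at hb'
        have h2 := hL (show u + 1 ≤ b.1 by omega)
        by_contra hlt
        by_cases h3 : b'.1 ≤ u + 1
        · have := hM h3
          omega
        · exact hout b'.1 ⟨by omega, by omega⟩
  · by_cases hW : M (u + 1) < c
    · have hout := fun r => h.not_outer (r := r) hu hv (Or.inl hW)
      have hdown : ∀ r, M r < L r → r ≤ u + 1 := fun r hr => by
        by_contra hlt
        have := hM (show u + 1 ≤ r by omega)
        exact hout r ⟨hr, by omega⟩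
      by_cases hc : M u < c
      · refine Or.inl ⟨u, c - 1, hbox (c - 1) (fun r hr => ?_) ?_ ?_ ?_ ?_⟩
        · by_contra hne
          have h1 := hdown r hr
          have h2 := hL (show r ≤ u by omega)
          exact h.not_outer (u := u) (c := c - 1) (r := r) (by omega) (by omega) (by omega)
            ⟨hr, by omega⟩
        all_goals
          have := h.not_left_right (u := u) (c := c - 1) (by omega) (by omega)
          omega
      · refine Or.inr (Or.inr fun b hb => ?_)
        rw [hD] at hb
        rcases (hdown b.1 (by omega)).eq_or_lt with h1 | h1
        · refine Or.inl fun b' hb' => ?_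
          rw [hD] at hb'
          have := hdown b'.1 (by omega)
          omega
        · refine Or.inr fun b' hb' => ?_
          rw [hD] at hb'
          have h2 := hM (show b.1 ≤ u by omega)
          by_contra hlt
          by_cases h3 : u ≤ b'.1
          · have := hL h3
            omega
          · exact hout b'.1 ⟨by omega, by omega⟩
    · have hinner : ∀ b ∈ D, ¬ IsOuterRow L M u c b.1 → b.2 = c := fun b hb hout => by
        rw [hD] at hb
        have h1 : M b.1 < L b.1 := by omega
        have h2 : ¬ (u + 1 < b.1 ∧ M b.1 < c) := fun h' => hout ⟨h1, Or.inl h'⟩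
        have h3 : ¬ (b.1 < u ∧ c + 1 < L b.1) := fun h' => hout ⟨h1, Or.inr h'⟩
        have h4 : b.1 ≤ u + 1 → M (u + 1) ≤ M b.1 := fun h' => hM h'
        have h5 : u ≤ b.1 → L b.1 ≤ L u := fun h' => hL h'
        omega
      by_cases hex : ∃ r, IsOuterRow L M u c r
      · obtain ⟨r, hr⟩ := hex
        have huniq : ∀ r', IsOuterRow L M u c r' → r' = r :=
          fun r' hr' => h.outer_unique hu hv hr' hr
        have hr0 := hr
        obtain ⟨hr1, hr2 | hr2⟩ := hr0
        · refine Or.inr (Or.inr fun b hb => ?_)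
          by_cases hbr : b.1 = r
          · refine Or.inl fun b' hb' => ?_
            by_contra hlt
            rw [hD] at hb'
            have h1 := hM (show r ≤ b'.1 by omega)
            have := huniq b'.1 ⟨by omega, by omega⟩
            omega
          · have h1 := hinner b hb fun h' => hbr (huniq _ h')
            refine Or.inr fun b' hb' => ?_
            by_cases h' : IsOuterRow L M u c b'.1
            · have h2 := huniq _ h'
              rw [hD] at hb'
              have h3 := hL (show u ≤ b'.1 by omega)
              omega
            · have := hinner b' hb' h'
              omega
        · refine Or.inr (Or.inl fun b hb => ?_)
          by_cases hbr : b.1 = r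
          · refine Or.inl fun b' hb' => ?_
            by_contra hlt
            rw [hD] at hb'
            have h1 := hL (show b'.1 ≤ r by omega)
            have := huniq b'.1 ⟨by omega, by omega⟩
            omega
          · have h1 := hinner b hb fun h' => hbr (huniq _ h')
            refine Or.inr fun b' hb' => ?_
            by_cases h' : IsOuterRow L M u c b'.1
            · have h2 := huniq _ h'
              rw [hD] at hb'
              have h3 := hM (show b'.1 ≤ u + 1 by omega)
              omega
            · have := hinner b' hb' h'
              omega
      · push Not at hex
        refine Or.inr (Or.inl fun b hb => Or.inr fun b' hb' => ?_)
        rw [hinner b hb (hex _), hinner b' hb' (hex _)]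

/-! ### Integrality by a monotone perturbation. -/

theorem gtPolytope_level_monotone {k n : ℕ} {lam mu : Fin n → ℕ} {w : Fin k → ℕ}
    {x : Fin (k + 1) → Fin n → ℝ} (hx : x ∈ gtPolytope lam mu w) (j : Fin n) :
    Monotone fun i => x i j :=
  Fin.monotone_iff_le_succ.2 fun i => hx.1.le_succ i j

theorem le_apply_of_mem_gtPolytope {k n : ℕ} {lam mu : Fin n → ℕ} {w : Fin k → ℕ}
    {x : Fin (k + 1) → Fin n → ℝ} (hx : x ∈ gtPolytope lam mu w) (i : Fin (k + 1)) (j : Fin n) :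
    (mu j : ℝ) ≤ x i j := by
  rw [← hx.2.1 j]
  exact gtPolytope_level_monotone hx j (Fin.zero_le i)

theorem apply_le_of_mem_gtPolytope {k n : ℕ} {lam mu : Fin n → ℕ} {w : Fin k → ℕ}
    {x : Fin (k + 1) → Fin n → ℝ} (hx : x ∈ gtPolytope lam mu w) (i : Fin (k + 1)) (j : Fin n) :
    x i j ≤ lam j := by
  rw [← hx.2.2.1 j]
  exact gtPolytope_level_monotone hx j (Fin.le_last i)

/-- A monotone function which fixes the integers and moves all other reals. -/
noncomputable def squeeze (t : ℝ) : ℝ := ⌊t⌋ + Int.fract t ^ 2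

theorem squeeze_intCast (z : ℤ) : squeeze z = z := by simp [squeeze]

theorem floor_eq_or_floor_add_one_le {s t : ℝ} (h : s ≤ t) :
    (⌊s⌋ = ⌊t⌋ ∧ Int.fract s ≤ Int.fract t) ∨ ((⌊s⌋ : ℝ) + 1 ≤ ⌊t⌋) := by
  rcases (Int.floor_mono h).eq_or_lt with h' | h'
  · left
    refine ⟨h', ?_⟩
    rw [Int.fract, Int.fract, h']
    linarith
  · right
    exact_mod_cast h'

theorem squeeze_monotone : Monotone squeeze := by
  intro s t h
  have h1 := Int.fract_nonneg s
  have h2 := Int.fract_lt_one s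
  have h3 := Int.fract_nonneg t
  unfold squeeze
  rcases floor_eq_or_floor_add_one_le h with ⟨h4, h5⟩ | h4
  · rw [h4]
    gcongr
  · nlinarith

/-- Within a unit interval `squeeze` has slope `2 * Int.fract t`, which is at most 2. -/
theorem two_mul_sub_squeeze_monotone : Monotone fun t => 2 * t - squeeze t := by
  intro s t h
  have h1 := Int.fract_nonneg s
  have h2 := Int.fract_lt_one s
  have h3 := Int.fract_nonneg t
  have h3' := Int.fract_lt_one t
  have e1 := Int.floor_add_fract s
  have e2 := Int.floor_add_fract t
  simp only [squeeze]
  rcases floor_eq_or_floor_add_one_le h with ⟨h4, h5⟩ | h4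
  · rw [h4] at e1 ⊢
    nlinarith
  · nlinarith

theorem exists_int_of_squeeze_eq {t : ℝ} (h : squeeze t = t) : ∃ z : ℤ, t = z := by
  have h1 := Int.fract_lt_one t
  have h2 := Int.floor_add_fract t
  have h3 : Int.fract t * (1 - Int.fract t) = 0 := by
    unfold squeeze at h
    nlinarith
  rcases mul_eq_zero.1 h3 with h4 | h4
  · exact ⟨⌊t⌋, by linarith⟩
  · linarith

/-- Apply `φ` to all columns of `x` but column `j₀`, which is adjusted so that the sums of the rows
do not change. -/
noncomputable def adjust {k n : ℕ} (φ : ℝ → ℝ) (j₀ : Fin n) (x : Fin (k + 1) → Fin n → ℝ) :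
    Fin (k + 1) → Fin n → ℝ := fun i j =>
  if j = j₀ then x i j₀ + ∑ j' ∈ Finset.univ.erase j₀, (x i j' - φ (x i j')) else φ (x i j)

section

variable {k n : ℕ} {lam mu : Fin n → ℕ} {φ : ℝ → ℝ} {j₀ : Fin n} {x : Fin (k + 1) → Fin n → ℝ}

theorem adjust_of_ne {j : Fin n} (hj : j ≠ j₀) (i : Fin (k + 1)) :
    adjust φ j₀ x i j = φ (x i j) := by
  simp [adjust, hj]

theorem sum_adjust (i : Fin (k + 1)) : ∑ j, adjust φ j₀ x i j = ∑ j, x i j := by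
  rw [← Finset.add_sum_erase _ _ (Finset.mem_univ j₀),
    ← Finset.add_sum_erase _ (x i) (Finset.mem_univ j₀),
    Finset.sum_congr rfl fun j hj => adjust_of_ne (Finset.ne_of_mem_erase hj) i]
  simp [adjust]
  ring

theorem adjust_self (hx : x ∈ gtPolytope lam mu (fun _ : Fin k => 1)) (i : Fin (k + 1)) :
    adjust φ j₀ x i j₀ = mu j₀ + (i : ℕ) - ∑ j ∈ Finset.univ.erase j₀, (φ (x i j) - mu j) := by
  have h := sum_level_of_mem_gtPolytope hx i
  rw [← Finset.add_sum_erase _ _ (Finset.mem_univ j₀),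
    ← Finset.add_sum_erase _ (fun j => (mu j : ℝ)) (Finset.mem_univ j₀)] at h
  simp only [adjust, if_true, Finset.sum_sub_distrib]
  linarith

theorem adjust_zero (hφ : ∀ z : ℤ, φ z = z) (hx : x ∈ gtPolytope lam mu (fun _ : Fin k => 1))
    (j : Fin n) : adjust φ j₀ x 0 j = mu j := by
  have h : ∀ j, φ (mu j) = mu j := fun j => by simpa using hφ (mu j)
  unfold adjust
  split_ifs with hj
  · simp [hx.2.1, h, hj]
  · simp [hx.2.1, h]

theorem adjust_last (hφ : ∀ z : ℤ, φ z = z) (hx : x ∈ gtPolytope lam mu (fun _ : Fin k => 1))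
    (j : Fin n) : adjust φ j₀ x (Fin.last k) j = lam j := by
  have h : ∀ j, φ (lam j) = lam j := fun j => by simpa using hφ (lam j)
  unfold adjust
  split_ifs with hj
  · simp [hx.2.2.1, h, hj]
  · simp [hx.2.2.1, h]

/-- Monotonicity of `φ` preserves every inequality not involving `j₀`, and non-negativity follows
from growth above `mu`; the three remaining kinds of inequality are the hypotheses. -/
theorem adjust_mem_gtPolytope (hφm : Monotone φ) (hφ : ∀ z : ℤ, φ z = z)
    (hx : x ∈ gtPolytope lam mu (fun _ : Fin k => 1))
    (hmono : ∀ i : Fin k, adjust φ j₀ x i.castSucc j₀ ≤ adjust φ j₀ x i.succ j₀)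
    (hbelow : ∀ (i : Fin k) (j : Fin n), (j₀ : ℕ) + 1 = j →
      φ (x i.succ j) ≤ adjust φ j₀ x i.castSucc j₀)
    (habove : ∀ (i : Fin k) (j : Fin n), (j : ℕ) + 1 = j₀ →
      adjust φ j₀ x i.succ j₀ ≤ φ (x i.castSucc j)) :
    adjust φ j₀ x ∈ gtPolytope lam mu (fun _ : Fin k => 1) := by
  have hle : ∀ (i : Fin k) (j : Fin n), adjust φ j₀ x i.castSucc j ≤ adjust φ j₀ x i.succ j := by
    intro i j
    by_cases hj : j = j₀
    · exact hj ▸ hmono i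
    · rw [adjust_of_ne hj, adjust_of_ne hj]
      exact hφm (hx.1.le_succ i j)
  refine ⟨⟨fun i j => ?_, hle, fun i j j' hj => ?_⟩, adjust_zero hφ hx, adjust_last hφ hx,
    fun i => ?_⟩
  · have h := (Fin.monotone_iff_le_succ (f := fun i => adjust φ j₀ x i j)).2 fun i => hle i j
    have h0 := h (Fin.zero_le i)
    simp only [adjust_zero hφ hx] at h0
    exact le_trans (Nat.cast_nonneg _) h0
  · by_cases h1 : j = j₀
    · subst h1
      have h2 : j' ≠ j := by rintro rfl; omega
      rw [adjust_of_ne h2]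
      exact hbelow i j' hj
    · rw [adjust_of_ne h1]
      by_cases h2 : j' = j₀
      · subst h2
        exact habove i j hj
      · rw [adjust_of_ne h2]
        exact hφm (hx.1.succ_le i j j' hj)
  · rw [sum_adjust, sum_adjust]
    exact hx.2.2.2 i

end

/-- Adjusting by `squeeze` and by its reflection gives two points with midpoint `x`. If `x` is
extreme its entries outside `j₀` are therefore fixed by `squeeze`, hence integers, and the level
sums settle `j₀`. -/
theorem isIntegralPolytope_of_adjust_mem {k n : ℕ} {lam mu : Fin n → ℕ} (j₀ : Fin n)
    (h : ∀ x ∈ gtPolytope lam mu (fun _ : Fin k => 1), ∀ φ : ℝ → ℝ, Monotone φ →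
      (∀ z : ℤ, φ z = z) → adjust φ j₀ x ∈ gtPolytope lam mu (fun _ : Fin k => 1)) :
    IsIntegralPolytope (gtPolytope lam mu (fun _ : Fin k => 1)) := by
  rintro x ⟨hx, hext⟩ i j
  have h1 := h x hx squeeze squeeze_monotone squeeze_intCast
  have h2 := h x hx _ two_mul_sub_squeeze_monotone fun z => by rw [squeeze_intCast]; ring
  have h3 := hext h1 h2 ⟨1 / 2, 1 / 2, by norm_num, by norm_num, by norm_num, ?_⟩
  · have hne : ∀ j ≠ j₀, ∃ z : ℤ, x i j = z := fun j hj => by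
      apply exists_int_of_squeeze_eq
      rw [← adjust_of_ne (φ := squeeze) hj, h3]
    by_cases hj : j = j₀
    · subst hj
      have hs := sum_level_of_mem_gtPolytope hx i
      choose! z hz using hne
      rw [← Finset.add_sum_erase _ _ (Finset.mem_univ j),
        Finset.sum_congr rfl fun j' hj' => hz j' (Finset.ne_of_mem_erase hj')] at hs
      refine ⟨∑ j, (mu j : ℤ) + (i : ℕ) - ∑ j' ∈ Finset.univ.erase j, z j', ?_⟩
      push_cast
      linarith
    · exact hne j hj
  · funext i j
    simp only [Pi.add_apply, Pi.smul_apply, smul_eq_mul, adjust]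
    split_ifs with hj
    · subst hj
      have : ∑ j' ∈ Finset.univ.erase j, (x i j' - (2 * x i j' - squeeze (x i j'))) =
          - ∑ j' ∈ Finset.univ.erase j, (x i j' - squeeze (x i j')) := by
        rw [← Finset.sum_neg_distrib]
        exact Finset.sum_congr rfl fun _ _ => by ring
      rw [this]
      ring
    · ring

/-- The total length of disjoint subintervals of `[lo, hi]` is at most `hi - lo`. -/
theorem sum_sub_le_of_interlacing : ∀ {n : ℕ} {A B : Fin n → ℝ} {lo hi : ℝ}, lo ≤ hi →
    (∀ j, lo ≤ A j) → (∀ j : Fin n, (j : ℕ) = 0 → B j ≤ hi) →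
    (∀ j j' : Fin n, (j : ℕ) + 1 = j' → B j' ≤ A j) → ∑ j, (B j - A j) ≤ hi - lo
  | 0, _, _, _, _, h, _, _, _ => by simpa using h
  | n + 1, A, B, lo, hi, _, hA, hB, hint => by
    have ih := sum_sub_le_of_interlacing (A := fun j => A (Fin.succ j))
      (B := fun j => B (Fin.succ j)) (hA 0) (fun j => hA j.succ)
      (fun j hj => hint 0 j.succ (by simp [hj]))
      (fun j j' hj => hint j.succ j'.succ (by simp [hj]))
    have h0 := hB 0 rfl
    rw [Fin.sum_univ_succ]
    linarith

/-- If all rows but row `j₀` together form a single column, then the adjusted pattern grows in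
column `j₀`. -/
theorem adjust_le_adjust_of_column {k n : ℕ} {lam mu : Fin n → ℕ} {φ : ℝ → ℝ} {j₀ : Fin n}
    {x : Fin (k + 1) → Fin n → ℝ} {c : ℕ} (hφm : Monotone φ) (hφ : ∀ z : ℤ, φ z = z)
    (hx : x ∈ gtPolytope lam mu (fun _ : Fin k => 1))
    (hcol : ∀ j ≠ j₀, lam j = mu j ∨ (mu j = c ∧ lam j = c + 1)) (i : Fin k) :
    adjust φ j₀ x i.castSucc j₀ ≤ adjust φ j₀ x i.succ j₀ := by
  -- Clamping to `[c, c + 1]` lets all rows take part in one interlacing chain: constant rows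
  -- contribute zero, row `j₀` a non-negative amount, and rows of the column are unchanged.
  obtain ⟨cl, hcl⟩ : ∃ cl : ℝ → ℝ, ∀ t, cl t = max (c : ℝ) (min t (c + 1)) := ⟨_, fun _ => rfl⟩
  have hclm : Monotone cl := fun s t h => by
    rw [hcl, hcl]
    gcongr
  have hc : φ c = c := by simpa using hφ c
  have hc1 : φ (c + 1) = c + 1 := by simpa using hφ (c + 1)
  have hterm : ∀ j ∈ Finset.univ.erase j₀, φ (x i.succ j) - φ (x i.castSucc j) =
      cl (φ (x i.succ j)) - cl (φ (x i.castSucc j)) := fun j hj => by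
    have h1 := fun i => le_apply_of_mem_gtPolytope hx i j
    have h2 := fun i => apply_le_of_mem_gtPolytope hx i j
    rcases hcol j (Finset.ne_of_mem_erase hj) with h | ⟨h, h'⟩
    · rw [h] at h2
      rw [le_antisymm (h2 i.succ) (h1 i.succ), le_antisymm (h2 i.castSucc) (h1 i.castSucc)]
      ring
    · rw [h] at h1
      rw [h'] at h2
      have h3 : ∀ i, cl (φ (x i j)) = φ (x i j) := fun i => by
        have h4 := hφm (h1 i)
        have h5 := hφm (h2 i)
        push_cast at h5
        rw [hc] at h4
        rw [hc1] at h5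
        rw [hcl, min_eq_left h5, max_eq_right h4]
      rw [h3, h3]
  have hsum : ∑ j, (cl (φ (x i.succ j)) - cl (φ (x i.castSucc j))) ≤ (c + 1 : ℝ) - c :=
    sum_sub_le_of_interlacing (by linarith) (fun j => by rw [hcl]; exact le_max_left _ _)
      (fun j _ => by rw [hcl]; exact max_le (by linarith) (min_le_right _ _))
      (fun j j' hj => hclm (hφm (hx.1.succ_le i j j' hj)))
  rw [← Finset.add_sum_erase _ _ (Finset.mem_univ j₀), ← Finset.sum_congr rfl hterm,
    Finset.sum_sub_distrib] at hsum
  have h0 : cl (φ (x i.castSucc j₀)) ≤ cl (φ (x i.succ j₀)) := hclm (hφm (hx.1.le_succ i j₀))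
  rw [adjust_self hx, adjust_self hx, Finset.sum_sub_distrib, Finset.sum_sub_distrib]
  push_cast [Fin.val_succ, Fin.val_castSucc]
  linarith

/-! ### Hooks and reverse hooks. -/

/-- In the first alternatives row `j₀` and its neighbour have no common column, so a constant
separates their entries. The second alternative of `hbelow` is a hook with its corner: the first
step must go entirely to row `j₀`, whose entry is then large enough for good. That of `habove` is a
reverse hook with its corner, whose last step is forced. -/
theorem isIntegralPolytope_of_column {k n : ℕ} {lam mu : Fin n → ℕ} (hlam : Antitone lam)
    (hmu : Antitone mu) (j₀ : Fin n) (c : ℕ)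
    (hcol : ∀ j ≠ j₀, lam j = mu j ∨ (mu j = c ∧ lam j = c + 1))
    (hbelow : ∀ j : Fin n, (j₀ : ℕ) + 1 = j → lam j ≤ mu j₀ ∨
      ∀ j ≠ j₀, lam j = mu j ∨ (j₀ < j ∧ mu j = mu j₀))
    (habove : ∀ j : Fin n, (j : ℕ) + 1 = j₀ → lam j₀ ≤ mu j ∨
      ∀ j ≠ j₀, lam j = mu j ∨ (j < j₀ ∧ lam j = lam j₀)) :
    IsIntegralPolytope (gtPolytope lam mu (fun _ : Fin k => 1)) := by
  refine isIntegralPolytope_of_adjust_mem j₀ fun x hx φ hφm hφ => ?_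
  have hφN : ∀ a : ℕ, φ a = a := fun a => by simpa using hφ a
  have hmono := adjust_le_adjust_of_column hφm hφ hx hcol
  have hmon : Monotone fun i => adjust φ j₀ x i j₀ := Fin.monotone_iff_le_succ.2 hmono
  refine adjust_mem_gtPolytope hφm hφ hx hmono (fun i j hj => ?_) (fun i j hj => ?_)
  · have hne : j ≠ j₀ := by rintro rfl; omega
    rcases hbelow j hj with h | h
    · have h1 := hφm (apply_le_of_mem_gtPolytope hx i.succ j)
      have h2 := hmon (Fin.zero_le i.castSucc)
      simp only [adjust_zero hφ hx] at h2
      rw [hφN] at h1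
      have h3 : (lam j : ℝ) ≤ mu j₀ := by exact_mod_cast h
      linarith
    · obtain ⟨k, rfl⟩ : ∃ k', k = k' + 1 := ⟨k - 1, by have := i.2; omega⟩
      by_cases hi : i = 0
      · subst hi
        have h1 := hφm (hx.1.succ_le 0 j₀ j hj)
        rw [Fin.castSucc_zero, hx.2.1, hφN] at h1
        rwa [Fin.castSucc_zero, adjust_zero hφ hx]
      -- No other row moves in the first step: `x 1 j'` is bounded by the bottom entry of the row
      -- above, which is at most `mu j₀ = mu j'`.
      · have h1 : ∀ j' ∈ Finset.univ.erase j₀, φ (x 1 j') - mu j' = 0 := fun j' hj' => by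
          have hx1 : x 1 j' = mu j' := by
            refine le_antisymm ?_ (le_apply_of_mem_gtPolytope hx 1 j')
            rcases h j' (Finset.ne_of_mem_erase hj') with h' | ⟨h', h''⟩
            · rw [← h']
              exact apply_le_of_mem_gtPolytope hx 1 j'
            · have h2 := hx.1.succ_le 0 ⟨(j' : ℕ) - 1, by omega⟩ j' (by simp only; omega)
              rw [Fin.castSucc_zero, hx.2.1, Fin.succ_zero_eq_one] at h2
              refine h2.trans ?_
              rw [h'']
              have : mu ⟨(j' : ℕ) - 1, by omega⟩ ≤ mu j₀ := hmu (by rw [Fin.le_def]; simp only; omega)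
              exact_mod_cast this
          rw [hx1, hφN, sub_self]
        have h2 : adjust φ j₀ x 1 j₀ = mu j₀ + 1 := by
          rw [adjust_self hx, Finset.sum_eq_zero h1]
          simp
        have h3 : (1 : Fin (k + 2)) ≤ i.castSucc := by
          rw [Fin.le_def]
          have : (i : ℕ) ≠ 0 := fun h => hi (Fin.ext h)
          simp only [Fin.val_one, Fin.val_castSucc]
          omega
        have h4 := hmon h3
        have h5 := hφm (apply_le_of_mem_gtPolytope hx i.succ j)
        rw [hφN] at h5
        have h6 : lam j ≤ mu j₀ + 1 := by
          have h7 := hmu (show j₀ ≤ j by rw [Fin.le_def]; omega)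
          rcases hcol j hne with h' | h' <;> omega
        have h7 : (lam j : ℝ) ≤ mu j₀ + 1 := by exact_mod_cast h6
        simp only [h2] at h4
        linarith
  · have hne : j ≠ j₀ := by rintro rfl; omega
    rcases habove j hj with h | h
    · have h1 := hφm (le_apply_of_mem_gtPolytope hx i.castSucc j)
      have h2 := hmon (Fin.le_last i.succ)
      simp only [adjust_last hφ hx] at h2
      rw [hφN] at h1
      have h3 : (lam j₀ : ℝ) ≤ mu j := by exact_mod_cast h
      linarith
    · obtain ⟨k, rfl⟩ : ∃ k', k = k' + 1 := ⟨k - 1, by have := i.2; omega⟩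
      by_cases hi : i = Fin.last k
      · subst hi
        have h1 := hφm (hx.1.succ_le (Fin.last k) j j₀ hj)
        rw [Fin.succ_last, hx.2.2.1, hφN] at h1
        rwa [Fin.succ_last, adjust_last hφ hx]
      -- Dually, every other row is complete before the last step.
      · have h1 : ∀ j' ∈ Finset.univ.erase j₀,
            φ (x (Fin.last k).castSucc j') - mu j' = lam j' - mu j' := fun j' hj' => by
          have hx1 : x (Fin.last k).castSucc j' = lam j' := by
            refine le_antisymm (apply_le_of_mem_gtPolytope hx _ j') ?_
            rcases h j' (Finset.ne_of_mem_erase hj') with h' | ⟨h', h''⟩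
            · rw [h']
              exact le_apply_of_mem_gtPolytope hx _ j'
            · have hlt : (j' : ℕ) + 1 < n := by rw [Fin.lt_def] at h'; omega
              have h2 := hx.1.succ_le (Fin.last k) j' ⟨(j' : ℕ) + 1, hlt⟩ rfl
              rw [Fin.succ_last, hx.2.2.1] at h2
              refine le_trans ?_ h2
              rw [h'']
              have : lam j₀ ≤ lam ⟨(j' : ℕ) + 1, hlt⟩ := hlam (by rw [Fin.le_def]; exact h')
              exact_mod_cast this
          rw [hx1, hφN]
        have h2 : adjust φ j₀ x (Fin.last k).castSucc j₀ = lam j₀ - 1 := by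
          have h3 := sum_eq_of_mem_gtPolytope hx
          have h4 : ∑ j, (lam j : ℝ) = ∑ j, (mu j : ℝ) + (k + 1) := by exact_mod_cast h3
          rw [← Finset.add_sum_erase _ _ (Finset.mem_univ j₀),
            ← Finset.add_sum_erase _ (fun j => (mu j : ℝ)) (Finset.mem_univ j₀)] at h4
          rw [adjust_self hx, Finset.sum_congr rfl h1, Finset.sum_sub_distrib]
          simp only [Fin.val_castSucc, Fin.val_last]
          linarith
        have h3 : i.succ ≤ (Fin.last k).castSucc := by
          rw [Fin.le_def]
          have : (i : ℕ) ≠ k := fun h => hi (Fin.ext h)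
          simp only [Fin.val_succ, Fin.val_castSucc, Fin.val_last]
          omega
        have h4 := hmon h3
        have h5 := hφm (le_apply_of_mem_gtPolytope hx i.castSucc j)
        rw [hφN] at h5
        have h6 : lam j₀ ≤ mu j + 1 := by
          have h7 := hlam (show j ≤ j₀ by rw [Fin.le_def]; omega)
          rcases hcol j hne with h' | h' <;> omega
        have h7 : (lam j₀ : ℝ) ≤ mu j + 1 := by exact_mod_cast h6
        simp only [h2] at h4
        linarith

/-! ### The square. -/

/-- Interlacing forces the lower row to be `c` at level 1 and `c + 1` at level 3. The only freedom
is its entry at level 2, in `[c, c + 1]`, an interval that `φ` preserves. -/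
theorem isIntegralPolytope_of_box {k n : ℕ} {lam mu : Fin n → ℕ} (hlam : Antitone lam) {a b : Fin n}
    (hab : (a : ℕ) + 1 = b) (c : ℕ) (hla : lam a = c + 2) (hma : mu a = c) (hlb : lam b = c + 2)
    (hmb : mu b = c) (hother : ∀ j, j ≠ a → j ≠ b → lam j = mu j) :
    IsIntegralPolytope (gtPolytope lam mu (fun _ : Fin k => 1)) := by
  refine isIntegralPolytope_of_adjust_mem a fun x hx φ hφm hφ => ?_
  have hne : b ≠ a := by rintro rfl; omega
  have hφN : ∀ m : ℕ, φ m = m := fun m => by simpa using hφ m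
  obtain rfl : k = 4 := by
    have h1 := sum_eq_of_mem_gtPolytope hx
    have h2 : ∑ j ∈ (Finset.univ.erase a).erase b, lam j = ∑ j ∈ (Finset.univ.erase a).erase b, mu j :=
      Finset.sum_congr rfl fun j hj => by
        simp only [Finset.mem_erase] at hj
        exact hother j hj.2.1 hj.1
    have hb : b ∈ Finset.univ.erase a := by simp [hne]
    rw [← Finset.add_sum_erase _ _ (Finset.mem_univ a), ← Finset.add_sum_erase _ _ hb,
      ← Finset.add_sum_erase _ mu (Finset.mem_univ a), ← Finset.add_sum_erase _ mu hb, h2] at h1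
    omega
  have hself : ∀ ψ : ℝ → ℝ, (∀ z : ℤ, ψ z = z) → ∀ i : Fin 5,
      adjust ψ a x i a = c + (i : ℕ) - (ψ (x i b) - c) := fun ψ hψ i => by
    rw [adjust_self hx, Finset.sum_eq_single b, hma, hmb]
    · intro j hj hjb
      have h1 := le_apply_of_mem_gtPolytope hx i j
      have h2 := apply_le_of_mem_gtPolytope hx i j
      rw [hother j (Finset.ne_of_mem_erase hj) hjb] at h2
      have h3 : ψ (mu j) = mu j := by simpa using hψ (mu j)
      rw [le_antisymm h2 h1, h3, sub_self]
    · simp [hne]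
  have hxa : ∀ i : Fin 5, x i a = c + (i : ℕ) - (x i b - c) := fun i => by
    have := hself id (fun _ => rfl) i
    simpa [adjust] using this
  have hadj := hself φ hφ
  have e0 : x 0 b = c := by rw [hx.2.1, hmb]
  have e4 : x 4 b = c + 2 := by
    rw [show (4 : Fin 5) = Fin.last 4 from rfl, hx.2.2.1, hlb]
    push_cast
    ring
  have hint : ∀ i : Fin 4, x i.succ b ≤ x i.castSucc a := fun i => hx.1.succ_le i a b hab
  have hc := fun i => le_apply_of_mem_gtPolytope hx i b
  rw [hmb] at hc
  have e1 : x 1 b = c := by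
    have h1 : x 1 b ≤ x 0 a := hint 0
    rw [hxa 0, e0] at h1
    have := hc 1
    simp at h1
    linarith
  have e2 : x 2 b ≤ c + 1 := by
    have h1 : x 2 b ≤ x 1 a := hint 1
    rw [hxa 1, e1] at h1
    simpa using h1
  -- The completed lower row at level 4 squeezes `x 3 a` to `c + 2`; the level sum then gives `x 3
  -- b`.
  have e3 : x 3 b = c + 1 := by
    have h1 : x 4 b ≤ x 3 a := hint 3
    have h2 : x 3 a ≤ lam a := apply_le_of_mem_gtPolytope hx 3 a
    have h3 := hxa 3
    have h4 : ((3 : Fin 5) : ℕ) = 3 := rfl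
    rw [hla] at h2
    rw [h4] at h3
    push_cast at h2 h3
    linarith
  have hc1 : φ (c + 1) = c + 1 := by simpa using hφ (c + 1)
  have hc2 : φ (c + 2) = c + 2 := by simpa using hφ (c + 2)
  have f0 : φ (x 0 b) = c := by rw [e0, hφN]
  have f1 : φ (x 1 b) = c := by rw [e1, hφN]
  have f2 : φ (x 2 b) ≤ c + 1 := hc1 ▸ hφm e2
  have f2' : c ≤ φ (x 2 b) := hφN c ▸ hφm (hc 2)
  have f3 : φ (x 3 b) = c + 1 := by rw [e3, hc1]
  have f4 : φ (x 4 b) = c + 2 := by rw [e4, hc2]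
  have a0 : adjust φ a x 0 a = c := by rw [hadj, f0]; simp
  have a1 : adjust φ a x 1 a = c + 1 := by rw [hadj, f1]; simp
  have a2 : adjust φ a x 2 a = c + 2 - (φ (x 2 b) - c) := by rw [hadj]; simp
  have a3 : adjust φ a x 3 a = c + 2 := by
    rw [hadj, f3, show ((3 : Fin 5) : ℕ) = 3 from rfl]; push_cast; ring
  have a4 : adjust φ a x 4 a = c + 2 := by
    rw [hadj, f4, show ((4 : Fin 5) : ℕ) = 4 from rfl]; push_cast; ring
  have hmono : ∀ i : Fin 4, adjust φ a x i.castSucc a ≤ adjust φ a x i.succ a := fun i => by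
    fin_cases i
    · change adjust φ a x 0 a ≤ adjust φ a x 1 a
      linarith
    · change adjust φ a x 1 a ≤ adjust φ a x 2 a
      linarith
    · change adjust φ a x 2 a ≤ adjust φ a x 3 a
      linarith
    · change adjust φ a x 3 a ≤ adjust φ a x 4 a
      linarith
  refine adjust_mem_gtPolytope hφm hφ hx hmono (fun i j hj => ?_) (fun i j hj => ?_)
  · obtain rfl : j = b := Fin.ext (by omega)
    fin_cases i
    · change φ (x 1 j) ≤ adjust φ a x 0 a
      linarith
    · change φ (x 2 j) ≤ adjust φ a x 1 a
      linarith
    · change φ (x 3 j) ≤ adjust φ a x 2 a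
      linarith
    · change φ (x 4 j) ≤ adjust φ a x 3 a
      linarith
  · have hmon : Monotone fun i => adjust φ a x i a := Fin.monotone_iff_le_succ.2 hmono
    have h1 := hmon (Fin.le_last i.succ)
    simp only [adjust_last hφ hx] at h1
    have h2 := hφm (le_apply_of_mem_gtPolytope hx i.castSucc j)
    have h3 : lam j = mu j := hother j (by rintro rfl; omega) (by rintro rfl; omega)
    have h4 : (lam a : ℝ) ≤ lam j := by
      exact_mod_cast hlam (show j ≤ a by rw [Fin.le_def]; omega)
    rw [hφN, ← h3] at h2
    linarith

/-! ### Disjoint rows and Birkhoff's theorem. -/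

/-- The pattern with bottom row `mu` in which the `i`-th step is the vector `d i`. -/
def patternOfSteps {k n : ℕ} (mu : Fin n → ℕ) (d : Fin k → Fin n → ℝ) :
    Fin (k + 1) → Fin n → ℝ :=
  fun i j => mu j + ∑ i' : Fin k, if i'.castSucc < i then d i' j else 0

section

variable {k n : ℕ} {lam mu : Fin n → ℕ} {d : Fin k → Fin n → ℝ}

theorem patternOfSteps_zero (j : Fin n) : patternOfSteps mu d 0 j = mu j := by
  simp [patternOfSteps]

theorem patternOfSteps_last (j : Fin n) :
    patternOfSteps mu d (Fin.last k) j = mu j + ∑ i, d i j := by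
  simp [patternOfSteps, Fin.castSucc_lt_last]

theorem patternOfSteps_succ (i : Fin k) (j : Fin n) :
    patternOfSteps mu d i.succ j = patternOfSteps mu d i.castSucc j + d i j := by
  have h : ∀ i' : Fin k, (if i'.castSucc < i.succ then d i' j else 0) =
      (if i'.castSucc < i.castSucc then d i' j else 0) + if i' = i then d i' j else 0 := by
    intro i'
    simp only [Fin.lt_def, Fin.ext_iff, Fin.val_castSucc, Fin.val_succ]
    rcases lt_trichotomy (i' : ℕ) i with h | h | h
    · rw [if_pos (by omega), if_pos h, if_neg (by omega), add_zero]
    · rw [if_pos (by omega), if_neg (by omega), if_pos h, zero_add]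
    · rw [if_neg (by omega), if_neg (by omega), if_neg (by omega), add_zero]
  simp only [patternOfSteps, h, Finset.sum_add_distrib, Finset.sum_ite_eq', Finset.mem_univ, if_true]
  ring

theorem eq_patternOfSteps {x : Fin (k + 1) → Fin n → ℝ} (h0 : ∀ j, x 0 j = mu j)
    (hs : ∀ i j, x i.succ j = x i.castSucc j + d i j) : x = patternOfSteps mu d := by
  funext i j
  induction i using Fin.induction with
  | zero => rw [h0, patternOfSteps_zero]
  | succ i ih => rw [hs, patternOfSteps_succ, ih]

/-- By `hrow` the constant `mu j` separates the entries of consecutive rows, so interlacing imposes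
nothing on the steps. -/
theorem patternOfSteps_mem_gtPolytope (hrow : ∀ j j' : Fin n, (j : ℕ) + 1 = j' → lam j' ≤ mu j)
    (hd : ∀ i j, 0 ≤ d i j) (hsum : ∀ i, ∑ j, d i j = 1)
    (hcol : ∀ j, ∑ i, d i j = (lam j : ℝ) - mu j) :
    patternOfSteps mu d ∈ gtPolytope lam mu (fun _ : Fin k => 1) := by
  have hlast : ∀ j, patternOfSteps mu d (Fin.last k) j = lam j := fun j => by
    rw [patternOfSteps_last, hcol]
    ring
  have hle : ∀ (i : Fin k) (j : Fin n),
      patternOfSteps mu d i.castSucc j ≤ patternOfSteps mu d i.succ j := fun i j => by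
    rw [patternOfSteps_succ]
    linarith [hd i j]
  have hmono : ∀ j, Monotone fun i => patternOfSteps mu d i j := fun j =>
    Fin.monotone_iff_le_succ.2 fun i => hle i j
  have hlow : ∀ i j, (mu j : ℝ) ≤ patternOfSteps mu d i j := fun i j => by
    have := hmono j (Fin.zero_le i)
    simpa only [patternOfSteps_zero] using this
  refine ⟨⟨fun i j => (Nat.cast_nonneg _).trans (hlow i j), hle, fun i j j' hj => ?_⟩,
    patternOfSteps_zero, hlast, fun i => ?_⟩
  · have h1 := hmono j' (Fin.le_last i.succ)
    simp only [hlast] at h1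
    have h2 : (lam j' : ℝ) ≤ mu j := by exact_mod_cast hrow j j' hj
    exact h1.trans (h2.trans (hlow _ _))
  · simp only [patternOfSteps_succ, Finset.sum_add_distrib, hsum]
    push_cast
    ring

end

theorem exists_fin_map_with_fibers {k n : ℕ} (m : Fin n → ℕ) (hk : k = ∑ j, m j) :
    ∃ g : Fin k → Fin n, ∀ j, (Finset.univ.filter fun t => g t = j).card = m j := by
  have hcard : Fintype.card (Fin k) = Fintype.card (Σ j : Fin n, Fin (m j)) := by simp [hk]
  obtain ⟨e⟩ := Fintype.card_eq.1 hcard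
  refine ⟨fun t => (e t).1, fun j => ?_⟩
  have hinj : Function.Injective fun s : Fin (m j) => e.symm ⟨j, s⟩ := fun s s' h => by simpa using h
  have h : (Finset.univ.filter fun t => (e t).1 = j) =
      (Finset.univ : Finset (Fin (m j))).image fun s => e.symm ⟨j, s⟩ := by
    ext t
    simp only [Finset.mem_filter, Finset.mem_univ, true_and, Finset.mem_image]
    constructor
    · rintro rfl
      exact ⟨(e t).2, by simp⟩
    · rintro ⟨s, rfl⟩
      simp
  rw [h, Finset.card_image_of_injective _ hinj, Finset.card_univ, Fintype.card_fin]

theorem convex_gtPolytope {k n : ℕ} (lam mu : Fin n → ℕ) (w : Fin k → ℕ) :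
    Convex ℝ (gtPolytope lam mu w) := by
  intro x hx y hy a b ha hb hab
  refine ⟨⟨fun i j => ?_, fun i j => ?_, fun i j j' hj => ?_⟩, fun j => ?_, fun j => ?_, fun i => ?_⟩
  all_goals simp only [Pi.add_apply, Pi.smul_apply, smul_eq_mul]
  · have := hx.1.nonneg i j
    have := hy.1.nonneg i j
    positivity
  · have := hx.1.le_succ i j
    have := hy.1.le_succ i j
    gcongr
  · have := hx.1.succ_le i j j' hj
    have := hy.1.succ_le i j j' hj
    gcongr
  · rw [hx.2.1, hy.2.1, ← add_mul, hab, one_mul]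
  · rw [hx.2.2.1, hy.2.2.1, ← add_mul, hab, one_mul]
  · have h1 := hx.2.2.2 i
    have h2 := hy.2.2.2 i
    simp only [Finset.sum_add_distrib, ← Finset.mul_sum]
    calc _ = a * (∑ j, x i.succ j - ∑ j, x i.castSucc j) +
          b * (∑ j, y i.succ j - ∑ j, y i.castSucc j) := by ring
      _ = w i := by rw [h1, h2, ← add_mul, hab, one_mul]

/-- The step matrix has row sums 1 and column sums `lam j - mu j`. Splitting each column into that
many equal columns gives a doubly stochastic matrix; writing it as a convex combination of
permutation matrices and merging the columns again expresses `x` through integral patterns. -/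
theorem isIntegralPolytope_of_rows {k n : ℕ} {lam mu : Fin n → ℕ} (hle : mu ≤ lam)
    (hk : k = ∑ j, (lam j - mu j))
    (hrow : ∀ j j' : Fin n, (j : ℕ) + 1 = j' → lam j' ≤ mu j) :
    IsIntegralPolytope (gtPolytope lam mu (fun _ : Fin k => 1)) := by
  classical
  obtain ⟨g, hg⟩ := exists_fin_map_with_fibers _ hk
  have hcast : ∀ j, ((lam j - mu j : ℕ) : ℝ) = lam j - mu j := fun j => Nat.cast_sub (hle j)
  intro x hxe
  have hx := hxe.1
  obtain ⟨d, hd⟩ : ∃ d : Fin k → Fin n → ℝ, ∀ i j, d i j = x i.succ j - x i.castSucc j :=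
    ⟨_, fun _ _ => rfl⟩
  have hd0 : ∀ i j, 0 ≤ d i j := fun i j => by
    rw [hd]
    linarith [hx.1.le_succ i j]
  have hxd : x = patternOfSteps mu d := eq_patternOfSteps hx.2.1 fun i j => by rw [hd]; ring
  have hdcol : ∀ j, ∑ i, d i j = (lam j : ℝ) - mu j := fun j => by
    have h1 := hx.2.2.1 j
    rw [hxd, patternOfSteps_last] at h1
    linarith
  have hdrow : ∀ i, ∑ j, d i j = 1 := fun i => by
    simp only [hd, Finset.sum_sub_distrib]
    simpa using hx.2.2.2 i
  -- For a row without boxes the division is by zero, but then the whole column of `d` vanishes.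
  have hdz : ∀ i j, ((lam j - mu j : ℕ) : ℝ) * (d i j / (lam j - mu j : ℕ)) = d i j := fun i j => by
    by_cases h : lam j - mu j = 0
    · have h1 : ∑ i, d i j = 0 := by rw [hdcol, ← hcast, h, Nat.cast_zero]
      have h2 := (Finset.sum_eq_zero_iff_of_nonneg fun i _ => hd0 i j).1 h1 i (Finset.mem_univ i)
      rw [h2]
      simp
    · have : ((lam j - mu j : ℕ) : ℝ) ≠ 0 := Nat.cast_ne_zero.2 h
      field_simp
  obtain ⟨B, hB⟩ : ∃ B : Matrix (Fin k) (Fin k) ℝ,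
      ∀ i t, B i t = d i (g t) / (lam (g t) - mu (g t) : ℕ) := ⟨_, fun _ _ => rfl⟩
  have hfiber : ∀ i j, ∑ t with g t = j, B i t = d i j := fun i j => by
    rw [← hdz i j, ← hg j, ← nsmul_eq_mul, ← Finset.sum_const]
    refine Finset.sum_congr rfl fun t ht => ?_
    rw [hB, (Finset.mem_filter.1 ht).2, hg]
  have hBm : B ∈ doublyStochastic ℝ (Fin k) := by
    rw [mem_doublyStochastic_iff_sum]
    refine ⟨fun i t => ?_, fun i => ?_, fun t => ?_⟩
    · rw [hB]
      exact div_nonneg (hd0 _ _) (Nat.cast_nonneg _)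
    · rw [← hdrow i, ← Finset.sum_fiberwise Finset.univ g]
      exact Finset.sum_congr rfl fun j _ => hfiber i j
    · simp only [hB, ← Finset.sum_div]
      rw [hdcol, ← hcast, div_self]
      rw [Nat.cast_ne_zero, ← hg]
      exact (Finset.card_pos.2 ⟨t, by simp⟩).ne'
  obtain ⟨w, hw0, hw1, hwB⟩ := exists_eq_sum_perm_of_mem_doublyStochastic hBm
  obtain ⟨D, hD⟩ : ∃ D : Equiv.Perm (Fin k) → Fin k → Fin n → ℝ,
      ∀ σ i j, D σ i j = if g (σ i) = j then 1 else 0 := ⟨_, fun _ _ _ => rfl⟩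
  have hdw : ∀ i j, d i j = ∑ σ, w σ * D σ i j := fun i j => by
    rw [← hfiber, ← hwB]
    simp only [Matrix.sum_apply, Matrix.smul_apply, smul_eq_mul]
    rw [Finset.sum_comm]
    refine Finset.sum_congr rfl fun σ _ => ?_
    rw [← Finset.mul_sum, hD]
    congr 1
    simp [Equiv.Perm.permMatrix, PEquiv.toMatrix_apply, Equiv.toPEquiv_apply, Finset.sum_ite_eq]
  have hmem : ∀ σ, patternOfSteps mu (D σ) ∈ gtPolytope lam mu (fun _ : Fin k => 1) := fun σ => by
    refine patternOfSteps_mem_gtPolytope hrow (fun i j => ?_) (fun i => ?_) (fun j => ?_)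
    · rw [hD]
      split_ifs <;> norm_num
    · simp [hD]
    · simp only [hD]
      rw [Equiv.sum_comp σ fun t => if g t = j then (1 : ℝ) else 0, Finset.sum_boole, hg, hcast]
  have hconv : x = ∑ σ, w σ • patternOfSteps mu (D σ) := by
    rw [hxd]
    symm
    refine eq_patternOfSteps (fun j => ?_) (fun i j => ?_)
    · simp [Finset.sum_apply, patternOfSteps_zero, ← Finset.sum_mul, hw1]
    · simp only [Finset.sum_apply, Pi.smul_apply, smul_eq_mul, patternOfSteps_succ, hdw, mul_add,
        Finset.sum_add_distrib]
  have hxh : x ∈ convexHull ℝ (Set.range fun σ => patternOfSteps mu (D σ)) := by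
    rw [hconv]
    exact (convex_convexHull ℝ _).sum_mem (fun σ _ => hw0 σ) hw1
      fun σ _ => subset_convexHull ℝ _ ⟨σ, rfl⟩
  have hsub : convexHull ℝ (Set.range fun σ => patternOfSteps mu (D σ)) ⊆
      gtPolytope lam mu (fun _ : Fin k => 1) := by
    refine convexHull_min ?_ (convex_gtPolytope _ _ _)
    rintro _ ⟨σ, rfl⟩
    exact hmem σ
  -- A vertex of the polytope lying in a hull contained in it is a vertex of that hull, hence one of
  -- the generating patterns.
  obtain ⟨σ, hσ⟩ := extremePoints_convexHull_subset
    (inter_extremePoints_subset_extremePoints_of_subset hsub ⟨hxh, hxe⟩)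
  intro i j
  refine ⟨(mu j : ℤ) + ∑ i' : Fin k, if i'.castSucc < i then (if g (σ i') = j then 1 else 0) else 0, ?_⟩
  rw [← hσ]
  simp [patternOfSteps, hD]

/-! ### Deleting empty rows and columns. -/

/-- The number of elements of `S` below `a`. -/
def rankIn (S : Finset ℕ) (a : ℕ) : ℕ := (S.filter (· < a)).card

theorem rankIn_monotone (S : Finset ℕ) : Monotone (rankIn S) := fun _ _ h =>
  Finset.card_le_card (Finset.monotone_filter_right S fun _ _ h' => lt_of_lt_of_le h' h)

theorem rankIn_lt {S : Finset ℕ} {a b : ℕ} (ha : a ∈ S) (h : a < b) : rankIn S a < rankIn S b :=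
  Finset.card_lt_card ⟨Finset.monotone_filter_right S fun _ _ h' => lt_trans h' h, fun h' => by
    have := h' (Finset.mem_filter.2 ⟨ha, h⟩)
    simp at this⟩

theorem rankIn_le_iff {S : Finset ℕ} {a b : ℕ} (hb : b ∈ S) :
    rankIn S a ≤ rankIn S b ↔ a ≤ b :=
  ⟨fun h => by
    by_contra h'
    have := rankIn_lt hb (not_le.1 h')
    omega, fun h => rankIn_monotone S h⟩

theorem rankIn_injOn (S : Finset ℕ) : Set.InjOn (rankIn S) S := fun _ ha _ hb h =>
  le_antisymm ((rankIn_le_iff hb).1 h.le) ((rankIn_le_iff ha).1 h.ge)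

theorem image_rankIn (S : Finset ℕ) : S.image (rankIn S) = Finset.range S.card := by
  apply Finset.eq_of_subset_of_card_le
  · intro m hm
    obtain ⟨a, ha, rfl⟩ := Finset.mem_image.1 hm
    rw [Finset.mem_range]
    refine Finset.card_lt_card ⟨Finset.filter_subset _ _, fun h => ?_⟩
    have := h ha
    simp at this
  · rw [Finset.card_range, Finset.card_image_of_injOn (rankIn_injOn S)]

theorem mem_deleteEmpty {D : Finset (ℕ × ℕ)} {e : ℕ × ℕ} :
    e ∈ deleteEmpty D ↔
      ∃ b ∈ D, rankIn (D.image Prod.fst) b.1 = e.1 ∧ rankIn (D.image Prod.snd) b.2 = e.2 := by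
  simp only [deleteEmpty, rankIn, Finset.mem_image, Prod.ext_iff]

theorem rankIn_fst_le_iff {D : Finset (ℕ × ℕ)} {b b' : ℕ × ℕ} (h : b' ∈ D) :
    rankIn (D.image Prod.fst) b.1 ≤ rankIn (D.image Prod.fst) b'.1 ↔ b.1 ≤ b'.1 :=
  rankIn_le_iff (Finset.mem_image_of_mem _ h)

theorem rankIn_snd_le_iff {D : Finset (ℕ × ℕ)} {b b' : ℕ × ℕ} (h : b' ∈ D) :
    rankIn (D.image Prod.snd) b.2 ≤ rankIn (D.image Prod.snd) b'.2 ↔ b.2 ≤ b'.2 :=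
  rankIn_le_iff (Finset.mem_image_of_mem _ h)

theorem forall_mem_deleteEmpty {D : Finset (ℕ × ℕ)} {p : ℕ × ℕ → Prop} :
    (∀ e ∈ deleteEmpty D, p e) ↔
      ∀ b ∈ D, p (rankIn (D.image Prod.fst) b.1, rankIn (D.image Prod.snd) b.2) := by
  constructor
  · exact fun h b hb => h _ (mem_deleteEmpty.2 ⟨b, hb, rfl, rfl⟩)
  · rintro h ⟨e1, e2⟩ he
    obtain ⟨b, hb, h1, h2⟩ := mem_deleteEmpty.1 he
    simp only at h1 h2
    exact h1 ▸ h2 ▸ h b hb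

/-- Only comparisons of coordinates of boxes occur, and ranks preserve and reflect them. -/
theorem isHookShape_deleteEmpty_iff {D : Finset (ℕ × ℕ)} :
    IsHookShape (deleteEmpty D) ↔ IsHookShape D := by
  simp only [IsHookShape, forall_mem_deleteEmpty]
  refine forall₂_congr fun b _ => or_congr (forall₂_congr fun b' hb' => ?_)
    (forall₂_congr fun b' hb' => ?_)
  · exact rankIn_fst_le_iff hb'
  · exact rankIn_snd_le_iff hb'

theorem isReverseHookShape_deleteEmpty_iff {D : Finset (ℕ × ℕ)} :
    IsReverseHookShape (deleteEmpty D) ↔ IsReverseHookShape D := by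
  simp only [IsReverseHookShape, forall_mem_deleteEmpty]
  refine forall₂_congr fun b hb => or_congr (forall₂_congr fun b' _ => ?_)
    (forall₂_congr fun b' _ => ?_)
  · exact rankIn_fst_le_iff hb
  · exact rankIn_snd_le_iff hb

theorem image_fst_deleteEmpty (D : Finset (ℕ × ℕ)) :
    (deleteEmpty D).image Prod.fst = Finset.range (D.image Prod.fst).card := by
  rw [← image_rankIn, deleteEmpty, Finset.image_image, Finset.image_image]
  rfl

theorem image_snd_deleteEmpty (D : Finset (ℕ × ℕ)) :
    (deleteEmpty D).image Prod.snd = Finset.range (D.image Prod.snd).card := by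
  rw [← image_rankIn, deleteEmpty, Finset.image_image, Finset.image_image]
  rfl

theorem mem_hookDiagram {a b : ℕ} {e : ℕ × ℕ} :
    e ∈ hookDiagram a b ↔ (e.1 = 0 ∧ e.2 < a + 1) ∨ (e.1 < b + 1 ∧ e.2 = 0) := by
  simp only [hookDiagram, Finset.mem_union, Finset.mem_product, Finset.mem_singleton, Finset.mem_range]

theorem mem_reverseHookDiagram {a b : ℕ} {e : ℕ × ℕ} :
    e ∈ reverseHookDiagram a b ↔ (e.1 = b ∧ e.2 < a + 1) ∨ (e.1 < b + 1 ∧ e.2 = a) := by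
  simp only [reverseHookDiagram, Finset.mem_union, Finset.mem_product, Finset.mem_singleton,
    Finset.mem_range]

/-- Without empty rows and columns the first ones have index 0. A row `r > 0` can only contain `(r,
0)` and must contain it, and likewise for columns, so just the corner is undetermined. -/
theorem isHook_iff {E : Finset (ℕ × ℕ)} {h w : ℕ} (hE1 : E.image Prod.fst = Finset.range h)
    (hE2 : E.image Prod.snd = Finset.range w) : IsHook E ↔ IsHookShape E := by
  constructor
  · rintro ⟨a, b, rfl | rfl⟩ e he
    · rw [mem_hookDiagram] at he
      rcases he with he | he
      · exact Or.inl fun _ _ => by omega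
      · exact Or.inr fun _ _ => by omega
    · rw [Finset.mem_erase, mem_hookDiagram] at he
      rcases he.2 with he | he
      · exact Or.inl fun _ _ => by omega
      · exact Or.inr fun _ _ => by omega
  · intro hs
    have hlt1 : ∀ e ∈ E, e.1 < h := fun e he =>
      Finset.mem_range.1 (hE1 ▸ Finset.mem_image_of_mem _ he)
    have hlt2 : ∀ e ∈ E, e.2 < w := fun e he =>
      Finset.mem_range.1 (hE2 ▸ Finset.mem_image_of_mem _ he)
    have hex1 : ∀ r < h, ∃ e ∈ E, e.1 = r := fun r hr =>
      Finset.mem_image.1 (hE1 ▸ Finset.mem_range.2 hr)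
    have hex2 : ∀ d < w, ∃ e ∈ E, e.2 = d := fun d hd =>
      Finset.mem_image.1 (hE2 ▸ Finset.mem_range.2 hd)
    have hzero : ∀ e ∈ E, e.1 = 0 ∨ e.2 = 0 := fun e he => by
      have h1 := hlt1 e he
      have h2 := hlt2 e he
      rcases hs e he with h' | h'
      · obtain ⟨e', he', h3⟩ := hex1 0 (by omega)
        have := h' e' he'
        omega
      · obtain ⟨e', he', h3⟩ := hex2 0 (by omega)
        have := h' e' he'
        omega
    have hmem : ∀ e : ℕ × ℕ, e ≠ (0, 0) → (e ∈ E ↔ (e.1 = 0 ∧ e.2 < w) ∨ (e.1 < h ∧ e.2 = 0)) := by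
      rintro ⟨r, d⟩ hne
      simp only [ne_eq, Prod.mk.injEq, not_and] at hne ⊢
      constructor
      · intro he
        have h1 := hlt1 _ he
        have h2 := hlt2 _ he
        have h3 := hzero _ he
        simp only at h1 h2 h3
        omega
      · rintro (⟨rfl, hd⟩ | ⟨hr, rfl⟩)
        · obtain ⟨⟨r', d'⟩, he, rfl⟩ := hex2 d hd
          rcases hzero _ he with h3 | h3
          · simp only at h3
            exact h3 ▸ he
          · exact absurd h3 (hne rfl)
        · obtain ⟨⟨r', d'⟩, he, rfl⟩ := hex1 r hr
          rcases hzero _ he with h3 | h3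
          · exact absurd rfl (hne h3)
          · simp only at h3
            exact h3 ▸ he
    -- For empty `E` the truncated subtraction gives the one-box hook, whose corner is then erased.
    refine ⟨w - 1, h - 1, ?_⟩
    rcases E.eq_empty_or_nonempty with rfl | ⟨e, he⟩
    · obtain rfl : h = 0 := by simpa using congrArg Finset.card hE1.symm
      obtain rfl : w = 0 := by simpa using congrArg Finset.card hE2.symm
      right
      ext ⟨r, d⟩
      simp only [Finset.mem_erase, mem_hookDiagram, ne_eq, Prod.mk.injEq, Finset.notMem_empty]
      refine iff_of_false id ?_
      rintro ⟨h1, h2⟩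
      omega
    · have h1 := hlt1 e he
      have h2 := hlt2 e he
      have e1 : h - 1 + 1 = h := by omega
      have e2 : w - 1 + 1 = w := by omega
      by_cases h0 : (0, 0) ∈ E
      · left
        ext e
        rw [mem_hookDiagram, e1, e2]
        by_cases hne : e = (0, 0)
        · subst hne
          exact iff_of_true h0 (Or.inl ⟨rfl, Nat.zero_lt_of_lt h2⟩)
        · exact hmem e hne
      · right
        ext e
        rw [Finset.mem_erase, mem_hookDiagram, e1, e2]
        by_cases hne : e = (0, 0)
        · subst hne
          simp [h0]
        · simpa [hne] using hmem e hne

theorem isReverseHook_iff {E : Finset (ℕ × ℕ)} {h w : ℕ} (hE1 : E.image Prod.fst = Finset.range h)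
    (hE2 : E.image Prod.snd = Finset.range w) : IsReverseHook E ↔ IsReverseHookShape E := by
  constructor
  · rintro ⟨a, b, rfl | rfl⟩ e he
    · rw [mem_reverseHookDiagram] at he
      rcases he with he | he
      · exact Or.inl fun e' he' => by rw [mem_reverseHookDiagram] at he'; omega
      · exact Or.inr fun e' he' => by rw [mem_reverseHookDiagram] at he'; omega
    · rw [Finset.mem_erase, mem_reverseHookDiagram] at he
      rcases he.2 with he | he
      · exact Or.inl fun e' he' => by
          rw [Finset.mem_erase, mem_reverseHookDiagram] at he'; omega
      · exact Or.inr fun e' he' => by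
          rw [Finset.mem_erase, mem_reverseHookDiagram] at he'; omega
  · intro hs
    have hlt1 : ∀ e ∈ E, e.1 < h := fun e he =>
      Finset.mem_range.1 (hE1 ▸ Finset.mem_image_of_mem _ he)
    have hlt2 : ∀ e ∈ E, e.2 < w := fun e he =>
      Finset.mem_range.1 (hE2 ▸ Finset.mem_image_of_mem _ he)
    have hex1 : ∀ r < h, ∃ e ∈ E, e.1 = r := fun r hr =>
      Finset.mem_image.1 (hE1 ▸ Finset.mem_range.2 hr)
    have hex2 : ∀ d < w, ∃ e ∈ E, e.2 = d := fun d hd =>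
      Finset.mem_image.1 (hE2 ▸ Finset.mem_range.2 hd)
    have hlast : ∀ e ∈ E, e.1 = h - 1 ∨ e.2 = w - 1 := fun e he => by
      have h1 := hlt1 e he
      have h2 := hlt2 e he
      rcases hs e he with h' | h'
      · obtain ⟨e', he', h3⟩ := hex1 (h - 1) (by omega)
        have := h' e' he'
        omega
      · obtain ⟨e', he', h3⟩ := hex2 (w - 1) (by omega)
        have := h' e' he'
        omega
    have hmem : ∀ e : ℕ × ℕ, e ≠ (h - 1, w - 1) →
        (e ∈ E ↔ (e.1 = h - 1 ∧ e.2 < w) ∨ (e.1 < h ∧ e.2 = w - 1)) := by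
      rintro ⟨r, d⟩ hne
      simp only [ne_eq, Prod.mk.injEq, not_and] at hne ⊢
      constructor
      · intro he
        have h1 := hlt1 _ he
        have h2 := hlt2 _ he
        have h3 := hlast _ he
        simp only at h1 h2 h3
        omega
      · rintro (⟨rfl, hd⟩ | ⟨hr, rfl⟩)
        · obtain ⟨⟨r', d'⟩, he, rfl⟩ := hex2 d hd
          rcases hlast _ he with h3 | h3
          · simp only at h3
            exact h3 ▸ he
          · exact absurd h3 (hne rfl)
        · obtain ⟨⟨r', d'⟩, he, rfl⟩ := hex1 r hr
          rcases hlast _ he with h3 | h3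
          · exact absurd rfl (hne h3)
          · simp only at h3
            exact h3 ▸ he
    refine ⟨w - 1, h - 1, ?_⟩
    rcases E.eq_empty_or_nonempty with rfl | ⟨e, he⟩
    · obtain rfl : h = 0 := by simpa using congrArg Finset.card hE1.symm
      obtain rfl : w = 0 := by simpa using congrArg Finset.card hE2.symm
      right
      ext ⟨r, d⟩
      simp only [Finset.mem_erase, mem_reverseHookDiagram, ne_eq, Prod.mk.injEq,
        Finset.notMem_empty]
      refine iff_of_false id ?_
      rintro ⟨h1, h2⟩
      omega
    · have h1 := hlt1 e he
      have h2 := hlt2 e he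
      have e1 : h - 1 + 1 = h := by omega
      have e2 : w - 1 + 1 = w := by omega
      by_cases h0 : (h - 1, w - 1) ∈ E
      · left
        ext e
        rw [mem_reverseHookDiagram, e1, e2]
        by_cases hne : e = (h - 1, w - 1)
        · subst hne
          exact iff_of_true h0 (Or.inl ⟨rfl, Nat.sub_lt (by omega) one_pos⟩)
        · exact hmem e hne
      · right
        ext e
        rw [Finset.mem_erase, mem_reverseHookDiagram, e1, e2]
        by_cases hne : e = (h - 1, w - 1)
        · subst hne
          simp [h0]
        · simpa [hne] using hmem e hne

theorem isHook_deleteEmpty_iff {D : Finset (ℕ × ℕ)} : IsHook (deleteEmpty D) ↔ IsHookShape D := by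
  rw [isHook_iff (image_fst_deleteEmpty D) (image_snd_deleteEmpty D), isHookShape_deleteEmpty_iff]

theorem isReverseHook_deleteEmpty_iff {D : Finset (ℕ × ℕ)} :
    IsReverseHook (deleteEmpty D) ↔ IsReverseHookShape D := by
  rw [isReverseHook_iff (image_fst_deleteEmpty D) (image_snd_deleteEmpty D),
    isReverseHookShape_deleteEmpty_iff]

theorem deleteEmpty_domino_square (u c : ℕ) :
    deleteEmpty (({u, u + 1} : Finset ℕ) ×ˢ ({c, c + 1} : Finset ℕ)) = boxDiagram := by
  have h1 : (({u, u + 1} : Finset ℕ) ×ˢ ({c, c + 1} : Finset ℕ)).image Prod.fst = {u, u + 1} :=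
    Finset.product_image_fst ⟨c, by simp⟩
  have h2 : (({u, u + 1} : Finset ℕ) ×ˢ ({c, c + 1} : Finset ℕ)).image Prod.snd = {c, c + 1} :=
    Finset.product_image_snd ⟨u, by simp⟩
  have h3 : ∀ a : ℕ, rankIn {a, a + 1} a = 0 ∧ rankIn {a, a + 1} (a + 1) = 1 := fun a => by
    constructor <;> simp [rankIn, Finset.filter_insert, Finset.filter_singleton]
  ext ⟨r, d⟩
  rw [mem_deleteEmpty, h1, h2]
  simp only [boxDiagram, Finset.mem_product, Finset.mem_range, Finset.mem_insert,
    Finset.mem_singleton, Prod.exists]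
  constructor
  · rintro ⟨a, b, ⟨rfl | rfl, rfl | rfl⟩, h4, h5⟩ <;> simp only [h3] at h4 h5 <;> omega
  · rintro ⟨hr, hd⟩
    refine ⟨u + r, c + d, by omega, ?_, ?_⟩
    · obtain rfl | rfl : r = 0 ∨ r = 1 := by omega
      · exact (h3 u).1
      · exact (h3 u).2
    · obtain rfl | rfl : d = 0 ∨ d = 1 := by omega
      · exact (h3 c).1
      · exact (h3 c).2

/-- A skew shape is convex along rows and columns, so nothing empty can have been deleted between
the two rows or the two columns. -/
theorem exists_square_of_deleteEmpty_eq_box {L M : ℕ → ℕ} (hL : Antitone L) (hM : Antitone M)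
    {D : Finset (ℕ × ℕ)} (hD : ∀ b, b ∈ D ↔ M b.1 ≤ b.2 ∧ b.2 < L b.1)
    (h : deleteEmpty D = boxDiagram) :
    ∃ u c, D = ({u, u + 1} : Finset ℕ) ×ˢ ({c, c + 1} : Finset ℕ) := by
  obtain ⟨f, hf⟩ : ∃ f, f = rankIn (D.image Prod.fst) := ⟨_, rfl⟩
  obtain ⟨g, hg⟩ : ∃ g, g = rankIn (D.image Prod.snd) := ⟨_, rfl⟩
  have hfle : ∀ b ∈ D, ∀ b' ∈ D, (f b.1 ≤ f b'.1 ↔ b.1 ≤ b'.1) := fun b _ b' hb' =>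
    hf ▸ rankIn_fst_le_iff hb'
  have hgle : ∀ b ∈ D, ∀ b' ∈ D, (g b.2 ≤ g b'.2 ↔ b.2 ≤ b'.2) := fun b _ b' hb' =>
    hg ▸ rankIn_snd_le_iff hb'
  have hlt : ∀ b ∈ D, f b.1 < 2 ∧ g b.2 < 2 := fun b hb => by
    have : (f b.1, g b.2) ∈ boxDiagram := h ▸ mem_deleteEmpty.2 ⟨b, hb, by rw [hf], by rw [hg]⟩
    simpa [boxDiagram] using this
  have hex : ∀ r < 2, ∀ d < 2, ∃ b ∈ D, f b.1 = r ∧ g b.2 = d := fun r hr d hd => by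
    have : (r, d) ∈ deleteEmpty D := h ▸ by simp [boxDiagram, hr, hd]
    obtain ⟨b, hb, h1, h2⟩ := mem_deleteEmpty.1 this
    exact ⟨b, hb, hf ▸ h1, hg ▸ h2⟩
  obtain ⟨a, ha, a1, a2⟩ := hex 0 (by omega) 0 (by omega)
  obtain ⟨b, hb, b1, b2⟩ := hex 1 (by omega) 1 (by omega)
  have hrow : ∀ e ∈ D, e.1 = a.1 ∨ e.1 = b.1 := fun e he => by
    have h1 := hlt e he
    have h2 := hfle e he a ha
    have h3 := hfle a ha e he
    have h4 := hfle e he b hb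
    have h5 := hfle b hb e he
    omega
  have hcol : ∀ e ∈ D, e.2 = a.2 ∨ e.2 = b.2 := fun e he => by
    have h1 := hlt e he
    have h2 := hgle e he a ha
    have h3 := hgle a ha e he
    have h4 := hgle e he b hb
    have h5 := hgle b hb e he
    omega
  have hab1 : a.1 < b.1 := by
    have := hfle b hb a ha
    omega
  have hab2 : a.2 < b.2 := by
    have := hgle b hb a ha
    omega
  have hmem : ∀ r c, (r = a.1 ∨ r = b.1) → (c = a.2 ∨ c = b.2) → (r, c) ∈ D := by
    have hkey : ∀ r < 2, ∀ d < 2, ∃ e ∈ D, (r = 0 → e.1 = a.1) ∧ (r = 1 → e.1 = b.1) ∧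
        (d = 0 → e.2 = a.2) ∧ (d = 1 → e.2 = b.2) := fun r hr d hd => by
      obtain ⟨e, he, h1, h2⟩ := hex r hr d hd
      have := hfle e he a ha
      have := hfle b hb e he
      have := hgle e he a ha
      have := hgle b hb e he
      have := hrow e he
      have := hcol e he
      exact ⟨e, he, by omega, by omega, by omega, by omega⟩
    rintro r c (rfl | rfl) (rfl | rfl)
    · exact ha
    · obtain ⟨e, he, h1, -, -, h2⟩ := hkey 0 (by omega) 1 (by omega)
      rwa [← h1 rfl, ← h2 rfl]
    · obtain ⟨e, he, -, h1, h2, -⟩ := hkey 1 (by omega) 0 (by omega)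
      rwa [← h1 rfl, ← h2 rfl]
    · exact hb
  have hb1 : b.1 = a.1 + 1 := by
    have h1 := (hD _).1 (hmem b.1 a.2 (by omega) (by omega))
    have h2 := (hD _).1 ha
    have h3 := hL (show a.1 + 1 ≤ b.1 by omega)
    have h4 := hM (show a.1 ≤ a.1 + 1 by omega)
    have := hrow (a.1 + 1, a.2) ((hD _).2 (by simp only at h1 ⊢; omega))
    simp only at this
    omega
  have hb2 : b.2 = a.2 + 1 := by
    have h1 := (hD _).1 (hmem a.1 b.2 (by omega) (by omega))
    have h2 := (hD _).1 ha
    have := hcol (a.1, a.2 + 1) ((hD _).2 (by simp only at h1 ⊢; omega))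
    simp only at this
    omega
  refine ⟨a.1, a.2, ?_⟩
  ext ⟨r, c⟩
  simp only [Finset.mem_product, Finset.mem_insert, Finset.mem_singleton, ← hb1, ← hb2]
  exact ⟨fun he => ⟨hrow _ he, hcol _ he⟩, fun he => hmem r c he.1 he.2⟩

/-! ### Recognising disjoint unions of rows. -/

theorem mem_rowDiagram {a : ℕ} {e : ℕ × ℕ} : e ∈ rowDiagram a ↔ e.1 = 0 ∧ e.2 < a := by
  simp only [rowDiagram, Finset.mem_product, Finset.mem_singleton, Finset.mem_range]

theorem mem_disjointUnion {A B : Finset (ℕ × ℕ)} {e : ℕ × ℕ} :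
    e ∈ disjointUnion A B ↔ (∃ b ∈ A, b.1 = e.1 ∧ b.2 + diagramWidth B = e.2) ∨
      ∃ b ∈ B, b.1 + diagramHeight A = e.1 ∧ b.2 = e.2 := by
  simp only [disjointUnion, Finset.mem_union, Finset.mem_image, Prod.ext_iff]

theorem lt_diagramHeight {A : Finset (ℕ × ℕ)} {b : ℕ × ℕ} (hb : b ∈ A) : b.1 < diagramHeight A :=
  Nat.lt_of_succ_le (Finset.le_sup (f := fun c : ℕ × ℕ => c.1 + 1) hb)

theorem lt_diagramWidth {A : Finset (ℕ × ℕ)} {b : ℕ × ℕ} (hb : b ∈ A) : b.2 < diagramWidth A :=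
  Nat.lt_of_succ_le (Finset.le_sup (f := fun c : ℕ × ℕ => c.2 + 1) hb)

/-- Each row is shifted past the full width of the rows below it, so different rows share no column.
This alone is needed of `rowsDiagram` for sufficiency. -/
theorem row_eq_of_mem_rowsDiagram {l : List ℕ} : ∀ {b b' : ℕ × ℕ}, b ∈ rowsDiagram l →
    b' ∈ rowsDiagram l → b.2 = b'.2 → b.1 = b'.1 := by
  induction l with
  | nil => intro b b' hb; simp [rowsDiagram] at hb
  | cons a l ih =>
    intro b b' hb hb' h
    rw [rowsDiagram, mem_disjointUnion] at hb hb'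
    rcases hb with ⟨e, he, h1, h2⟩ | ⟨e, he, h1, h2⟩ <;>
      rcases hb' with ⟨e', he', h1', h2'⟩ | ⟨e', he', h1', h2'⟩
    · rw [mem_rowDiagram] at he he'
      omega
    · have := lt_diagramWidth he'
      omega
    · have := lt_diagramWidth he
      omega
    · have := ih he he' (by omega)
      omega

theorem diagramWidth_deleteEmpty (D : Finset (ℕ × ℕ)) :
    diagramWidth (deleteEmpty D) = (D.image Prod.snd).card := by
  apply le_antisymm
  · refine Finset.sup_le fun e he => ?_
    have : e.2 ∈ Finset.range (D.image Prod.snd).card :=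
      image_snd_deleteEmpty D ▸ Finset.mem_image_of_mem _ he
    exact Finset.mem_range.1 this
  · rcases Nat.eq_zero_or_pos (D.image Prod.snd).card with h | h
    · omega
    · have : (D.image Prod.snd).card - 1 ∈ (deleteEmpty D).image Prod.snd := by
        rw [image_snd_deleteEmpty, Finset.mem_range]
        omega
      obtain ⟨e, he, h1⟩ := Finset.mem_image.1 this
      have := lt_diagramWidth he
      omega

theorem diagramHeight_rowDiagram {a : ℕ} (ha : 0 < a) : diagramHeight (rowDiagram a) = 1 := by
  apply le_antisymm
  · refine Finset.sup_le fun e he => ?_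
    rw [mem_rowDiagram] at he
    omega
  · exact lt_diagramHeight (b := (0, 0)) (mem_rowDiagram.2 ⟨rfl, ha⟩)

/-- Peeling off the top row `r`: all other boxes are lower and strictly to the left, so their row
ranks drop by one and their column ranks stay, while the ranks in row `r` are offset by the number
of remaining columns. -/
theorem deleteEmpty_eq_disjointUnion {D : Finset (ℕ × ℕ)} {r : ℕ}
    (hr : ∀ b ∈ D, r ≤ b.1) (hne : ∃ b ∈ D, b.1 = r)
    (hD : ∀ b ∈ D, ∀ b' ∈ D, b.1 < b'.1 → b'.2 < b.2) :
    deleteEmpty D = disjointUnion (rowDiagram (D.filter fun b => b.1 = r).card)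
      (deleteEmpty (D.filter fun b => b.1 ≠ r)) := by
  obtain ⟨A, hA⟩ : ∃ A, A = D.filter fun b => b.1 = r := ⟨_, rfl⟩
  obtain ⟨B, hB⟩ : ∃ B, B = D.filter fun b => b.1 ≠ r := ⟨_, rfl⟩
  rw [← hA, ← hB]
  have hAm : ∀ b, b ∈ A ↔ b ∈ D ∧ b.1 = r := fun b => by rw [hA, Finset.mem_filter]
  have hBm : ∀ b, b ∈ B ↔ b ∈ D ∧ b.1 ≠ r := fun b => by rw [hB, Finset.mem_filter]
  have hAB : ∀ a ∈ A, ∀ b ∈ B, b.2 < a.2 := fun a ha b hb => by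
    rw [hAm] at ha
    rw [hBm] at hb
    have := hr b hb.1
    exact hD a ha.1 b hb.1 (by omega)
  have hApos : 0 < A.card := by
    obtain ⟨b, hb, h⟩ := hne
    exact Finset.card_pos.2 ⟨b, (hAm b).2 ⟨hb, h⟩⟩
  have hAcard : (A.image Prod.snd).card = A.card :=
    Finset.card_image_of_injOn fun a ha a' ha' h => by
      simp only [Finset.mem_coe, hAm] at ha ha'
      exact Prod.ext (by omega) h
  have hDu : D = A ∪ B := by
    rw [hA, hB, Finset.filter_union_filter_not_eq]
  have hrowB : ∀ b ∈ B, rankIn (D.image Prod.fst) b.1 = rankIn (B.image Prod.fst) b.1 + 1 := by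
    intro b hb
    have h1 : (D.image Prod.fst).filter (· < b.1) =
        insert r ((B.image Prod.fst).filter (· < b.1)) := by
      ext s
      simp only [Finset.mem_filter, Finset.mem_image, Finset.mem_insert]
      rw [hBm] at hb
      have := hr b hb.1
      constructor
      · rintro ⟨⟨e, he, rfl⟩, h⟩
        by_cases h' : e.1 = r
        · exact Or.inl h'
        · exact Or.inr ⟨⟨e, (hBm e).2 ⟨he, h'⟩, rfl⟩, h⟩
      · rintro (rfl | ⟨⟨e, he, rfl⟩, h⟩)
        · exact ⟨hne, by omega⟩
        · exact ⟨⟨e, ((hBm e).1 he).1, rfl⟩, h⟩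
    rw [rankIn, h1, Finset.card_insert_of_notMem, rankIn]
    intro h
    simp only [Finset.mem_filter, Finset.mem_image] at h
    obtain ⟨⟨e, he, h2⟩, -⟩ := h
    exact ((hBm e).1 he).2 h2
  have hrowA : rankIn (D.image Prod.fst) r = 0 := by
    rw [rankIn, Finset.card_eq_zero, Finset.filter_eq_empty_iff]
    intro s hs
    obtain ⟨e, he, rfl⟩ := Finset.mem_image.1 hs
    exact not_lt.2 (hr e he)
  have hcolB : ∀ b ∈ B, rankIn (D.image Prod.snd) b.2 = rankIn (B.image Prod.snd) b.2 := by
    intro b hb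
    unfold rankIn
    congr 1
    ext s
    simp only [Finset.mem_filter, Finset.mem_image]
    constructor
    · rintro ⟨⟨e, he, rfl⟩, h⟩
      refine ⟨⟨e, (hBm e).2 ⟨he, fun h' => ?_⟩, rfl⟩, h⟩
      have := hAB e ((hAm e).2 ⟨he, h'⟩) b hb
      omega
    · rintro ⟨⟨e, he, rfl⟩, h⟩
      exact ⟨⟨e, ((hBm e).1 he).1, rfl⟩, h⟩
  have hcolA : ∀ a ∈ A, rankIn (D.image Prod.snd) a.2 =
      rankIn (A.image Prod.snd) a.2 + (B.image Prod.snd).card := by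
    intro a ha
    have h1 : (B.image Prod.snd).filter (· < a.2) = B.image Prod.snd := by
      rw [Finset.filter_eq_self]
      intro s hs
      obtain ⟨e, he, rfl⟩ := Finset.mem_image.1 hs
      exact hAB a ha e he
    have h2 : Disjoint ((A.image Prod.snd).filter (· < a.2)) (B.image Prod.snd) := by
      rw [Finset.disjoint_left]
      intro s hs hs'
      obtain ⟨e, he, rfl⟩ := Finset.mem_image.1 (Finset.mem_filter.1 hs).1
      obtain ⟨e', he', h3⟩ := Finset.mem_image.1 hs'
      have := hAB e he e' he'
      omega
    rw [rankIn, hDu, Finset.image_union, Finset.filter_union, h1, Finset.card_union_of_disjoint h2,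
      rankIn]
  ext e
  rw [mem_disjointUnion, diagramHeight_rowDiagram hApos, diagramWidth_deleteEmpty, mem_deleteEmpty]
  constructor
  · rintro ⟨b, hb, h1, h2⟩
    by_cases hbr : b.1 = r
    · have hbA := (hAm b).2 ⟨hb, hbr⟩
      refine Or.inl ⟨(0, rankIn (A.image Prod.snd) b.2), ?_, ?_, ?_⟩
      · rw [mem_rowDiagram, ← hAcard, ← Finset.mem_range, ← image_rankIn]
        exact ⟨rfl, Finset.mem_image_of_mem _ (Finset.mem_image_of_mem _ hbA)⟩
      · rw [← h1, hbr, hrowA]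
      · rw [← h2, hcolA b hbA]
    · have hbB := (hBm b).2 ⟨hb, hbr⟩
      refine Or.inr ⟨(rankIn (B.image Prod.fst) b.1, rankIn (B.image Prod.snd) b.2),
        mem_deleteEmpty.2 ⟨b, hbB, rfl, rfl⟩, ?_, ?_⟩
      · rw [← h1, hrowB b hbB]
      · rw [← h2, hcolB b hbB]
  · rintro (⟨b, hb, h1, h2⟩ | ⟨b, hb, h1, h2⟩)
    · rw [mem_rowDiagram, ← hAcard, ← Finset.mem_range, ← image_rankIn] at hb
      obtain ⟨hb1, hb2⟩ := hb
      obtain ⟨s, hs, hb2⟩ := Finset.mem_image.1 hb2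
      obtain ⟨a, ha, rfl⟩ := Finset.mem_image.1 hs
      refine ⟨a, ((hAm a).1 ha).1, ?_, ?_⟩
      · rw [((hAm a).1 ha).2, hrowA, ← h1, hb1]
      · rw [hcolA a ha, hb2, h2]
    · obtain ⟨b', hb', h3, h4⟩ := mem_deleteEmpty.1 hb
      refine ⟨b', ((hBm b').1 hb').1, ?_, ?_⟩
      · rw [hrowB b' hb', h3, h1]
      · rw [hcolB b' hb', h4, h2]

theorem isDisjointUnionOfRows_deleteEmpty {D : Finset (ℕ × ℕ)}
    (hD : ∀ b ∈ D, ∀ b' ∈ D, b.1 < b'.1 → b'.2 < b.2) : IsDisjointUnionOfRows (deleteEmpty D) := by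
  induction D using Finset.strongInduction with
  | H D ih =>
    rcases D.eq_empty_or_nonempty with rfl | hne
    · exact ⟨[], rfl⟩
    · obtain ⟨b, hb, hmin⟩ := Finset.exists_min_image D Prod.fst hne
      obtain ⟨l, hl⟩ := ih (D.filter fun e => e.1 ≠ b.1)
        (Finset.filter_ssubset.2 ⟨b, hb, fun h => h rfl⟩) fun e he e' he' =>
          hD e (Finset.mem_filter.1 he).1 e' (Finset.mem_filter.1 he').1
      exact ⟨_ :: l, by rw [deleteEmpty_eq_disjointUnion hmin ⟨b, hb, rfl⟩ hD, hl]; rfl⟩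

theorem row_eq_of_isDisjointUnionOfRows {D : Finset (ℕ × ℕ)}
    (h : IsDisjointUnionOfRows (deleteEmpty D)) {b b' : ℕ × ℕ} (hb : b ∈ D) (hb' : b' ∈ D)
    (hbb : b.2 = b'.2) : b.1 = b'.1 := by
  obtain ⟨l, hl⟩ := h
  have h1 : ∀ {b}, b ∈ D →
      (rankIn (D.image Prod.fst) b.1, rankIn (D.image Prod.snd) b.2) ∈ rowsDiagram l :=
    fun {b} hb => hl ▸ mem_deleteEmpty.2 ⟨b, hb, rfl, rfl⟩
  have h2 := row_eq_of_mem_rowsDiagram (h1 hb) (h1 hb') (by simp only [hbb])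
  exact rankIn_injOn _ (Finset.mem_coe.2 (Finset.mem_image_of_mem _ hb))
    (Finset.mem_coe.2 (Finset.mem_image_of_mem _ hb')) h2

/-! ### Translating diagrams back into partitions. -/

theorem mem_skewDiagram {n : ℕ} {lam mu : Fin n → ℕ} {b : ℕ × ℕ} :
    b ∈ skewDiagram lam mu ↔ extendZero mu b.1 ≤ b.2 ∧ b.2 < extendZero lam b.1 := by
  simp only [skewDiagram, Finset.mem_biUnion, Finset.mem_univ, true_and, Finset.mem_product,
    Finset.mem_singleton, Finset.mem_Ico]
  constructor
  · rintro ⟨i, h1, h2⟩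
    rwa [h1, extendZero_coe, extendZero_coe]
  · intro h
    have hn : b.1 < n := lt_of_extendZero_pos (f := lam) (by omega)
    refine ⟨⟨b.1, hn⟩, rfl, ?_⟩
    simpa [extendZero, hn] using h

theorem mk_mem_skewDiagram {n : ℕ} {lam mu : Fin n → ℕ} {j : Fin n} {d : ℕ} :
    ((j : ℕ), d) ∈ skewDiagram lam mu ↔ mu j ≤ d ∧ d < lam j := by
  rw [mem_skewDiagram]
  simp only [extendZero_coe]

section

variable {k n : ℕ} {lam mu : Fin n → ℕ}

theorem eq_of_skewDiagram_eq_empty (hle : mu ≤ lam) (h : skewDiagram lam mu = ∅) : lam = mu := by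
  funext j
  by_contra hne
  have h1 : ((j : ℕ), mu j) ∈ skewDiagram lam mu :=
    mk_mem_skewDiagram.2 ⟨le_rfl, lt_of_le_of_ne (hle j) (Ne.symm hne)⟩
  simp [h] at h1

theorem exists_fin_of_mem_skewDiagram {b : ℕ × ℕ} (hb : b ∈ skewDiagram lam mu) :
    ∃ j : Fin n, (j : ℕ) = b.1 ∧ mu j ≤ b.2 ∧ b.2 < lam j := by
  simp only [skewDiagram, Finset.mem_biUnion, Finset.mem_univ, true_and, Finset.mem_product,
    Finset.mem_singleton, Finset.mem_Ico] at hb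
  obtain ⟨j, h1, h2⟩ := hb
  exact ⟨j, h1.symm, h2⟩

/-- Take `j₀` to be the first nonempty row; every other nonempty row is a single box in the leftmost
column. -/
theorem isIntegralPolytope_of_isHookShape (hlam : Antitone lam) (hmu : Antitone mu) (hle : mu ≤ lam)
    (hne : (skewDiagram lam mu).Nonempty) (h : IsHookShape (skewDiagram lam mu)) :
    IsIntegralPolytope (gtPolytope lam mu (fun _ : Fin k => 1)) := by
  obtain ⟨b₁, hb₁, hmin₁⟩ := Finset.exists_min_image _ Prod.fst hne
  obtain ⟨b₂, hb₂, hmin₂⟩ := Finset.exists_min_image _ Prod.snd hne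
  obtain ⟨j₀, hj₀, hj₀'⟩ := exists_fin_of_mem_skewDiagram hb₁
  have hfirst : ∀ j, mu j < lam j → j₀ ≤ j ∧ b₂.2 ≤ mu j := fun j hj => by
    have hm := mk_mem_skewDiagram.2 ⟨le_rfl, hj⟩
    have h1 := hmin₁ _ hm
    have h2 := hmin₂ _ hm
    exact ⟨by rw [Fin.le_def]; omega, h2⟩
  have hcol : ∀ j ≠ j₀, lam j = mu j ∨ (mu j = b₂.2 ∧ lam j = b₂.2 + 1) := fun j hj => by
    rcases (show mu j ≤ lam j from hle j).eq_or_lt with h' | h'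
    · exact Or.inl h'.symm
    · right
      have hd : ∀ d, mu j ≤ d → d < lam j → d ≤ b₂.2 := fun d h1 h2 => by
        rcases h _ (mk_mem_skewDiagram.2 ⟨h1, h2⟩) with h3 | h3
        · have h4 := h3 _ hb₁
          have h5 := (hfirst j h').1
          exact absurd (Fin.ext (by rw [Fin.le_def] at h5; simp only at h4; omega)) hj
        · exact h3 _ hb₂
      have h1 := (hfirst j h').2
      have h2 := hd (mu j) le_rfl h'
      have h3 := hd (lam j - 1) (by omega) (by omega)
      omega
  refine isIntegralPolytope_of_column hlam hmu j₀ b₂.2 hcol (fun j hj => ?_) (fun j hj => ?_)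
  -- If the row after `j₀` reaches beyond `mu j₀`, then row `j₀` must start in the leftmost column:
  -- the corner is present.
  · rw [or_iff_not_imp_left]
    intro hlt j' hj'
    have h1 := hmu (show j₀ ≤ j by rw [Fin.le_def]; omega)
    have h2 := hcol j (by rintro rfl; omega)
    have h3 := (hfirst j₀ (by omega)).2
    rcases hcol j' hj' with h4 | h4
    · exact Or.inl h4
    · exact Or.inr ⟨lt_of_le_of_ne (hfirst j' (by omega)).1 hj'.symm, by omega⟩
  · left
    have h1 := hlam (show j ≤ j₀ by rw [Fin.le_def]; omega)
    rcases (show mu j ≤ lam j from hle j).eq_or_lt with h' | h'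
    · omega
    · have h2 := (hfirst j h').1
      rw [Fin.le_def] at h2
      omega

/-- Mirror image of the hook: `j₀` is the last nonempty row and the other boxes are in the rightmost
column. -/
theorem isIntegralPolytope_of_isReverseHookShape (hlam : Antitone lam) (hmu : Antitone mu)
    (hle : mu ≤ lam) (hne : (skewDiagram lam mu).Nonempty)
    (h : IsReverseHookShape (skewDiagram lam mu)) :
    IsIntegralPolytope (gtPolytope lam mu (fun _ : Fin k => 1)) := by
  obtain ⟨b₁, hb₁, hmax₁⟩ := Finset.exists_max_image _ Prod.fst hne
  obtain ⟨b₂, hb₂, hmax₂⟩ := Finset.exists_max_image _ Prod.snd hne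
  obtain ⟨j₀, hj₀, hj₀'⟩ := exists_fin_of_mem_skewDiagram hb₁
  have hlast : ∀ j, mu j < lam j → j ≤ j₀ ∧ lam j ≤ b₂.2 + 1 := fun j hj => by
    have hm := (mk_mem_skewDiagram (lam := lam) (mu := mu) (j := j) (d := lam j - 1)).2 ⟨by omega, by omega⟩
    have h1 := hmax₁ _ hm
    have h2 := hmax₂ _ hm
    exact ⟨by rw [Fin.le_def]; omega, by simp only at h2; omega⟩
  have hcol : ∀ j ≠ j₀, lam j = mu j ∨ (mu j = b₂.2 ∧ lam j = b₂.2 + 1) := fun j hj => by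
    rcases (show mu j ≤ lam j from hle j).eq_or_lt with h' | h'
    · exact Or.inl h'.symm
    · right
      have hd : ∀ d, mu j ≤ d → d < lam j → b₂.2 ≤ d := fun d h1 h2 => by
        rcases h _ (mk_mem_skewDiagram.2 ⟨h1, h2⟩) with h3 | h3
        · have h4 := h3 _ hb₁
          have h5 := (hlast j h').1
          exact absurd (Fin.ext (by rw [Fin.le_def] at h5; simp only at h4; omega)) hj
        · exact h3 _ hb₂
      have h1 := (hlast j h').2
      have h2 := hd (mu j) le_rfl h'
      omega
  refine isIntegralPolytope_of_column hlam hmu j₀ b₂.2 hcol (fun j hj => ?_) (fun j hj => ?_)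
  · left
    have h1 := hmu (show j₀ ≤ j by rw [Fin.le_def]; omega)
    rcases (show mu j ≤ lam j from hle j).eq_or_lt with h' | h'
    · omega
    · have h2 := (hlast j h').1
      rw [Fin.le_def] at h2
      omega
  · rw [or_iff_not_imp_left]
    intro hlt j' hj'
    have h1 := hlam (show j ≤ j₀ by rw [Fin.le_def]; omega)
    have h2 := hcol j (by rintro rfl; omega)
    have h3 := (hlast j₀ (by omega)).2
    rcases hcol j' hj' with h4 | h4
    · exact Or.inl h4
    · exact Or.inr ⟨lt_of_le_of_ne (hlast j' (by omega)).1 hj', by omega⟩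

theorem isIntegralPolytope_of_square (hlam : Antitone lam) (hle : mu ≤ lam) {u c : ℕ}
    (h : skewDiagram lam mu = ({u, u + 1} : Finset ℕ) ×ˢ ({c, c + 1} : Finset ℕ)) :
    IsIntegralPolytope (gtPolytope lam mu (fun _ : Fin k => 1)) := by
  have hmem : ∀ (j : Fin n) (d : ℕ), (mu j ≤ d ∧ d < lam j) ↔
      ((j : ℕ) = u ∨ (j : ℕ) = u + 1) ∧ (d = c ∨ d = c + 1) := fun j d => by
    rw [← mk_mem_skewDiagram, h]
    simp
  have hrow : ∀ r, r = u ∨ r = u + 1 → ∃ j : Fin n, (j : ℕ) = r ∧ mu j = c ∧ lam j = c + 2 :=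
      fun r hr => by
    obtain ⟨j, hj, -⟩ := exists_fin_of_mem_skewDiagram (b := (r, c)) (lam := lam) (mu := mu)
      (by rw [h]; simpa using hr)
    have hj' : (j : ℕ) = r := hj
    have h1 := (hmem j c).2 ⟨hj' ▸ hr, Or.inl rfl⟩
    have h2 := (hmem j (c + 1)).2 ⟨hj' ▸ hr, Or.inr rfl⟩
    have h3 := (hmem j (mu j)).1 (by omega)
    have h4 := (hmem j (lam j - 1)).1 (by omega)
    exact ⟨j, hj', by omega, by omega⟩
  obtain ⟨a, ha, ha1, ha2⟩ := hrow u (Or.inl rfl)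
  obtain ⟨b, hb, hb1, hb2⟩ := hrow (u + 1) (Or.inr rfl)
  refine isIntegralPolytope_of_box hlam (a := a) (b := b) (by omega) c ha2 ha1 hb2 hb1
    fun j hja hjb => ?_
  rcases (show mu j ≤ lam j from hle j).eq_or_lt with h' | h'
  · exact h'.symm
  · have h1 := (hmem j (mu j)).1 ⟨le_rfl, h'⟩
    rcases h1.1 with h2 | h2
    · exact absurd (Fin.ext (by omega)) hja
    · exact absurd (Fin.ext (by omega)) hjb

end

/-! ### The classification. -/

theorem mainTheorem2 {n : ℕ} (lam mu : Fin n → ℕ) (hlam : Antitone lam) (hmu : Antitone mu)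
    (hle : mu ≤ lam) :
    IsIntegralPolytope (gtPolytope lam mu (onesWeight lam mu)) ↔
      (IsDisjointUnionOfRows (deleteEmpty (skewDiagram lam mu)) ∨
        deleteEmpty (skewDiagram lam mu) = boxDiagram ∨
        IsHook (deleteEmpty (skewDiagram lam mu)) ∨
        IsReverseHook (deleteEmpty (skewDiagram lam mu))) := by
  have hLa := antitone_extendZero hlam
  have hMa := antitone_extendZero hmu
  rw [isHook_deleteEmpty_iff, isReverseHook_deleteEmpty_iff]
  constructor
  · intro h
    rcases (hasSmallDominoes_of_isIntegralPolytope hlam hmu hle h).classification hLa hMa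
      (fun _ => mem_skewDiagram) with h | ⟨u, c, h⟩ | h | h
    · refine Or.inl (isDisjointUnionOfRows_deleteEmpty fun b hb b' hb' hbb => ?_)
      rw [mem_skewDiagram] at hb hb'
      have h1 := h b.1
      have h2 := hLa (show b.1 + 1 ≤ b'.1 by omega)
      omega
    · exact Or.inr (Or.inl (h ▸ deleteEmpty_domino_square u c))
    · exact Or.inr (Or.inr (Or.inl h))
    · exact Or.inr (Or.inr (Or.inr h))
  · have hrows : (∀ j j' : Fin n, (j : ℕ) + 1 = j' → lam j' ≤ mu j) →
        IsIntegralPolytope (gtPolytope lam mu (onesWeight lam mu)) :=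
      isIntegralPolytope_of_rows hle rfl
    -- The hook arguments choose extremal boxes, so the empty diagram is treated apart, as an
    -- instance of disjoint rows.
    rcases (skewDiagram lam mu).eq_empty_or_nonempty with hD | hne
    · intro _
      have := eq_of_skewDiagram_eq_empty hle hD
      refine hrows fun j j' hj => ?_
      rw [this]
      exact hmu (by rw [Fin.le_def]; omega)
    rintro (h | h | h | h)
    · refine hrows fun j j' hj => ?_
      -- Otherwise column `mu j` meets both consecutive rows.
      by_contra hlt
      have h1 := hlam (show j ≤ j' by rw [Fin.le_def]; omega)
      have h2 := hmu (show j ≤ j' by rw [Fin.le_def]; omega)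
      have := row_eq_of_isDisjointUnionOfRows h
        ((mk_mem_skewDiagram (lam := lam) (mu := mu) (j := j) (d := mu j)).2 ⟨le_rfl, by omega⟩)
        ((mk_mem_skewDiagram (lam := lam) (mu := mu) (j := j') (d := mu j)).2 ⟨h2, by omega⟩) rfl
      simp only at this
      omega
    · obtain ⟨u, c, h⟩ := exists_square_of_deleteEmpty_eq_box hLa hMa (fun _ => mem_skewDiagram) h
      exact isIntegralPolytope_of_square hlam hle h
    · exact isIntegralPolytope_of_isHookShape hlam hmu hle hne h
    · exact isIntegralPolytope_of_isReverseHookShape hlam hmu hle hne h
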